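/- Let $\mathbb{R}^+=[0,\infty)$ with Lebesgue measure. For $j\in\mathbb{Z}$ and $k\in\{0,1,2,\dots\}$ let $I^j_k=[k2^{-j},(k+1)2^{-j})$ be the dyadic intervals, let $h^j_k(x)=2^{j/2}h^0_0(2^jx-k)$ with $h^0_0=\chi_{[0,1/2)}-\chi_{[1/2,1)}$ be the Haar functions, let $\mathscr{H}=\{h^j_k\}$, and for $h=h^j_k$ write $I(h)=I^j_k$ and $j(h)=j$. For $x,y\in\mathbb{R}^+$ let $\delta(x,y)$ be the infimum of the lengths $|I|$ of the dyadic intervals $I$ that contain both $x$ and $y$. Let $K:\mathbb{R}^+\times\mathbb{R}^+\to[0,\infty)$ depend only on $\delta$ (that is, $\delta(x,y)=\delta(x',y')$ implies $K(x,y)=K(x',y')$) and satisfy $\int_{\mathbb{R}^+}K(x_0,y)\,dy=1$ for some $x_0\in\mathbb{R}^+$. Let $Tf(x)=\int_{\mathbb{R}^+}K(x,y)f(y)\,dy$. Let $k_j$ be the constant value of $K$ on $\{\delta=2^j\}$, let $\alpha_l=2^{-l}(k_{-l}-k_{-l+1})$ and $\Lambda_j=\sum_{l>j}\alpha_l$,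 and for $h\in\mathscr{H}$ let $\lambda(h)=\Lambda_{j(h)}$ (the eigenvalue of $T$ at $h$). Let $1<p<\infty$. Then for every real-valued $f\in L^p(\mathbb{R}^+)$ the integral defining $Tf(x)$ converges absolutely for almost every $x\in\mathbb{R}^+$ and $Tf\in L^p(\mathbb{R}^+)$, and there are constants $C_1,C_2\in(0,\infty)$, which do not depend on $f$, such that for every real-valued $f\in L^p(\mathbb{R}^+)$ $$C_1\|Tf\|_p\le\Bigl\|\Bigl(\sum_{h\in\mathscr{H}}\lambda(h)^2\,|\langle f,h\rangle|^2\,|I(h)|^{-1}\chi_{I(h)}\Bigr)^{1/2}\Bigr\|_p\le C_2\|Tf\|_p ,$$ where $\langle f,h\rangle=\int_{\mathbb{R}^+}f(x)h(x)\,dx$. -/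

import Mathlib

open MeasureTheory Set
open scoped ENNReal NNReal

namespace DyadicMarkov

noncomputable section

/-- Lebesgue measure on `ℝ⁺ = [0, ∞)`, as a measure on `ℝ`. -/
def posVolume : Measure ℝ := volume.restrict (Ici 0)

/-- The dyadic interval `I^j_k = [k 2^{-j}, (k+1) 2^{-j})`. -/
def dyadicInterval (j : ℤ) (k : ℕ) : Set ℝ :=
  Ico ((k : ℝ) * (2 : ℝ) ^ (-j)) (((k : ℝ) + 1) * (2 : ℝ) ^ (-j))

/-- The dyadic distance: the infimum of the lengths of the dyadic intervals containing both points.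
It is used for points of `ℝ⁺` only. -/
def dyadicDist (x y : ℝ) : ℝ :=
  sInf {r : ℝ | ∃ (j : ℤ) (k : ℕ), x ∈ dyadicInterval j k ∧ y ∈ dyadicInterval j k ∧
    r = volume.real (dyadicInterval j k)}

/-- The mother Haar function `χ_{[0,1/2)} - χ_{[1/2,1)}`. -/
def haarMother (x : ℝ) : ℝ :=
  (Ico (0 : ℝ) (1 / 2)).indicator 1 x - (Ico (1 / 2 : ℝ) 1).indicator 1 x

/-- The Haar function `h^j_k(x) = 2^{j/2} h^0_0(2^j x - k)`, supported in `dyadicInterval j k`. -/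
def haar (j : ℤ) (k : ℕ) (x : ℝ) : ℝ :=
  (2 : ℝ) ^ ((j : ℝ) / 2) * haarMother ((2 : ℝ) ^ j * x - k)

/-- The Haar coefficient `⟨f, h^j_k⟩`. -/
def haarCoeff (f : ℝ → ℝ) (j : ℤ) (k : ℕ) : ℝ := ∫ x, f x * haar j k x ∂posVolume

/-- The class `𝒦`: nonnegative kernels on `ℝ⁺ × ℝ⁺` that depend only on the dyadic distance and
have integral `1` in the second variable at some point. Only the values on `ℝ⁺ × ℝ⁺` matter. -/
structure IsDyadicMarkovKernel (K : ℝ → ℝ → ℝ) : Prop where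
  nonneg : ∀ x y : ℝ, 0 ≤ x → 0 ≤ y → 0 ≤ K x y
  depends_only : ∀ x y x' y' : ℝ, 0 ≤ x → 0 ≤ y → 0 ≤ x' → 0 ≤ y' →
    dyadicDist x y = dyadicDist x' y' → K x y = K x' y'
  exists_integral_eq_one : ∃ x₀ : ℝ, 0 ≤ x₀ ∧ ∫ y, K x₀ y ∂posVolume = 1

/-- The operator `Tf(x) = ∫_{ℝ⁺} K(x,y) f(y) dy`. -/
def kernelOp (K : ℝ → ℝ → ℝ) (f : ℝ → ℝ) (x : ℝ) : ℝ := ∫ y, K x y * f y ∂posVolume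

/-- The coefficient `k_j`: the constant value of `K` on the level set `{δ = 2^j}`, read off at the
point `(0, 2^{j-1})` of this level set (see `IsDyadicMarkovKernel.eq_levelCoeff`). -/
def levelCoeff (K : ℝ → ℝ → ℝ) (j : ℤ) : ℝ := K 0 ((2 : ℝ) ^ (j - 1))

/-- `α_l = 2^{-l} (k_{-l} - k_{-l+1})`. -/
def alphaCoeff (K : ℝ → ℝ → ℝ) (l : ℤ) : ℝ :=
  (2 : ℝ) ^ (-l) * (levelCoeff K (-l) - levelCoeff K (-l + 1))

/-- `Λ_j = ∑_{l > j} α_l`, the eigenvalue `λ(h)` of `T` at every Haar function `h = h^j_k` of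
level `j`. -/
def eigenvalue (K : ℝ → ℝ → ℝ) (j : ℤ) : ℝ := ∑' l : {l : ℤ // j < l}, alphaCoeff K l

/-- The square function
`(∑_h λ(h)² |⟨f,h⟩|² |I(h)|^{-1} χ_{I(h)}(x))^{1/2}`, with values in `[0, ∞]`. -/
def haarSquareFunction (K : ℝ → ℝ → ℝ) (f : ℝ → ℝ) (x : ℝ) : ℝ≥0∞ :=
  (∑' q : ℤ × ℕ, ENNReal.ofReal
    (eigenvalue K q.1 ^ 2 * |haarCoeff f q.1 q.2| ^ 2 *
      (volume.real (dyadicInterval q.1 q.2))⁻¹ *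
      (dyadicInterval q.1 q.2).indicator 1 x)) ^ (1 / 2 : ℝ)

theorem volume_real_dyadicInterval (j : ℤ) (k : ℕ) :
    volume.real (dyadicInterval j k) = (2 : ℝ) ^ (-j) := by
  have h : (0 : ℝ) < (2 : ℝ) ^ (-j) := by positivity
  rw [dyadicInterval, Real.volume_real_Ico_of_le (by nlinarith)]
  ring

theorem dyadicDist_zero_zpow (j : ℤ) : dyadicDist 0 ((2 : ℝ) ^ (j - 1)) = (2 : ℝ) ^ j := by
  apply IsLeast.csInf_eq
  constructor
  · refine ⟨-j, 0, ?_, ?_, ?_⟩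
    · simp [dyadicInterval]; positivity
    · simp only [dyadicInterval, Nat.cast_zero, zero_mul, zero_add, one_mul, neg_neg, mem_Ico]
      exact ⟨by positivity, zpow_lt_zpow_right₀ (by norm_num) (by omega)⟩
    · rw [volume_real_dyadicInterval, neg_neg]
  · rintro r ⟨i, k, h0, h1, rfl⟩
    rw [volume_real_dyadicInterval]
    have hp : (0 : ℝ) < (2 : ℝ) ^ (-i) := by positivity
    have hk : (k : ℝ) = 0 := by
      have h2 : (k : ℝ) * (2 : ℝ) ^ (-i) ≤ 0 := h0.1
      have h3 : (0 : ℝ) ≤ k := Nat.cast_nonneg k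
      nlinarith
    have h4 : (2 : ℝ) ^ (j - 1) < (2 : ℝ) ^ (-i) := by simpa [hk] using h1.2
    have h5 : j - 1 < -i := (zpow_lt_zpow_iff_right₀ (by norm_num)).1 h4
    exact zpow_le_zpow_right₀ (by norm_num) (by omega)

theorem IsDyadicMarkovKernel.eq_levelCoeff {K : ℝ → ℝ → ℝ} (hK : IsDyadicMarkovKernel K)
    {x y : ℝ} (hx : 0 ≤ x) (hy : 0 ≤ y) {j : ℤ} (h : dyadicDist x y = (2 : ℝ) ^ j) :
    K x y = levelCoeff K j :=
  hK.depends_only _ _ _ _ hx hy le_rfl (by positivity) (by rw [h, dyadicDist_zero_zpow])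

end

end DyadicMarkov

/-!
Since `K x` is constant on the set of points at dyadic distance `2 ^ (-n)` from `x`, which is the
dyadic interval of level `n` around `x` minus that of level `n + 1`, the operator `T` is the
series `∑ₙ mₙ (2 Eₙ - Eₙ₊₁)`, where `Eₙ` is the average over dyadic intervals of level `n` and the
numbers `mₙ` are summable. The `Eₙ` are contractions of `Lᵖ`, so the series converges there, and
it multiplies the difference `Eⱼ₊₁ f - Eⱼ f` by `Λⱼ`. As the square of this difference is the part
of the square function of `f` coming from Haar functions of level `j`, the weighted Haar square
function of `f` is the martingale square function of `T f`.

It remains to compare the `Lᵖ` norms of a dyadic martingale and of its square function. The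
increments of such a martingale have a conditionally symmetric distribution, and both inequalities
follow from functions of the value `x` of the martingale and the value `s` of its square function
that do not increase on average along symmetric steps `(x, s) ↦ (x ± d, √(s ^ 2 + d ^ 2))`, vanish
at the origin, and dominate a positive multiple of `s ^ p - C |x| ^ p`, respectively of `|x| ^ p -
C s ^ p`.
-/

namespace DyadicMarkov

noncomputable section

section RealInequalities

theorem rpow_sub_one_mul_self {r t : ℝ} (hr : r ≠ 0) (ht : 0 ≤ t) : t ^ (r - 1) * t = t ^ r := by
  rw [← Real.rpow_add_one' ht (by simpa), sub_add_cancel]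

theorem mul_rpow_sub_one_le_rpow {r s t u : ℝ} (hr : 1 ≤ r) (hs : 0 ≤ s) (ht : 0 ≤ t) (hsu : s ≤ u)
    (htu : t ≤ u) : s * t ^ (r - 1) ≤ u ^ r := by
  rw [← rpow_sub_one_mul_self (by linarith) (ht.trans htu)]
  have hu : 0 ≤ u := ht.trans htu
  exact (mul_comm s _).trans_le
    (mul_le_mul (Real.rpow_le_rpow ht htu (by linarith)) hsu hs (by positivity))

theorem mul_mul_rpow_sub_one_le {r s t : ℝ} (hr : 1 ≤ r) (hs : 0 ≤ s) (ht : 0 ≤ t) :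
    r * (s * t ^ (r - 1)) ≤ s ^ r + (r - 1) * t ^ r := by
  rcases hr.eq_or_lt with rfl | hr
  · simp
  have hconj : r.HolderConjugate (r / (r - 1)) := Real.HolderConjugate.conjExponent hr
  have hr₁ : r - 1 ≠ 0 := by linarith
  have young := Real.young_inequality_of_nonneg hs (Real.rpow_nonneg ht (r - 1)) hconj
  rw [← Real.rpow_mul ht, mul_div_cancel₀ _ hr₁] at young
  calc r * (s * t ^ (r - 1)) ≤ r * (s ^ r / r + t ^ r / (r / (r - 1))) := by gcongr
    _ = s ^ r + (r - 1) * t ^ r := by field_simp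

theorem exists_mul_rpow_sub_one_le {r : ℝ} (hr : 1 ≤ r) (A : ℝ) :
    ∃ C, 0 ≤ C ∧ ∀ s t : ℝ, 0 ≤ s → 0 ≤ t → A * (s * t ^ (r - 1)) ≤ C * s ^ r + t ^ r / 2 := by
  set L := 2 * (|A| + 1)
  have hLpos : 0 < L := by positivity
  refine ⟨L ^ r, by positivity, fun s t hs ht ↦ ?_⟩
  have young := mul_mul_rpow_sub_one_le hr (mul_nonneg hLpos.le hs) ht
  rw [Real.mul_rpow hLpos.le hs] at young
  have hLs : 0 ≤ L ^ r * s ^ r := by positivity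
  have hAL : 2 * A * (s * t ^ (r - 1)) ≤ L * (s * t ^ (r - 1)) := by
    gcongr
    linarith [le_abs_self A]
  have htr : 0 ≤ t ^ r := by positivity
  have hmul : r * (A * (s * t ^ (r - 1))) ≤ r * (L ^ r * s ^ r + t ^ r / 2) := by nlinarith
  exact le_of_mul_le_mul_left hmul (by linarith)

theorem rpow_sub_one_mul_le_rpow_sub_rpow {b s t : ℝ} (hb₀ : 0 ≤ b) (hb₁ : b ≤ 1) (hs : 0 ≤ s)
    (ht : 0 < t) : b * t ^ (b - 1) * (t - s) ≤ t ^ b - s ^ b := by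
  have tangent := rpow_one_add_le_one_add_mul_self (s := s / t - 1)
    (by linarith [div_nonneg hs ht.le]) hb₀ hb₁
  rw [add_sub_cancel, Real.div_rpow hs ht.le, div_le_iff₀ (by positivity)] at tangent
  have hexpand : (1 + b * (s / t - 1)) * t ^ b = t ^ b - b * t ^ (b - 1) * (t - s) := by
    rw [Real.rpow_sub_one ht.ne']
    field_simp
    ring
  linarith

theorem rpow_sub_rpow_le_max_mul {r u w : ℝ} (hr : 0 < r) (hu : 0 ≤ u) (huw : u ≤ w) :
    w ^ r - u ^ r ≤ max 1 r * (w ^ (r - 1) * (w - u)) := by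
  have hw_pow := rpow_sub_one_mul_self hr.ne' (hu.trans huw)
  rcases le_total r 1 with hr₁ | hr₁
  · have hu_pow : w ^ (r - 1) * u ≤ u ^ r := by
      rcases hu.eq_or_lt with rfl | hu
      · simp [Real.zero_rpow hr.ne']
      · rw [← rpow_sub_one_mul_self hr.ne' hu.le]
        gcongr ?_ * u
        exact Real.rpow_le_rpow_of_nonpos hu huw (by linarith)
    rw [max_eq_left hr₁]
    linarith
  · have young := mul_mul_rpow_sub_one_le hr₁ hu (hu.trans huw)
    rw [← hw_pow] at young ⊢
    rw [max_eq_right hr₁]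
    linarith

/-- The average of `(1 ± y)^r` is at most `cosh (r y) ≤ exp (r² y² / 2)`, and `exp` is convex. -/
theorem rpow_one_add_add_rpow_one_sub_le {r y : ℝ} (hr : 0 ≤ r) (hy : |y| ≤ 1) :
    ((1 + y) ^ r + (1 - y) ^ r) / 2 ≤ 1 + (Real.exp (r ^ 2 / 2) - 1) * y ^ 2 := by
  obtain ⟨hy₁, hy₂⟩ := abs_le.1 hy
  have hle_exp (z : ℝ) (hz : -1 ≤ z) : (1 + z) ^ r ≤ Real.exp (r * z) := by
    rw [mul_comm, Real.exp_mul]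
    exact Real.rpow_le_rpow (by linarith) (by linarith [Real.add_one_le_exp z]) hr
  have hy_sq : y ^ 2 ≤ 1 := (sq_le_one_iff_abs_le_one y).2 hy
  calc ((1 + y) ^ r + (1 - y) ^ r) / 2
      ≤ Real.cosh (r * y) := by
        rw [Real.cosh_eq, ← mul_neg, sub_eq_add_neg]
        gcongr <;> exact hle_exp _ (by linarith)
    _ ≤ Real.exp ((r * y) ^ 2 / 2) := Real.cosh_le_exp_half_sq _
    _ = Real.exp ((1 - y ^ 2) • 0 + y ^ 2 • (r ^ 2 / 2)) := by
        congr 1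
        simp only [smul_eq_mul]
        ring
    _ ≤ (1 - y ^ 2) • Real.exp 0 + y ^ 2 • Real.exp (r ^ 2 / 2) :=
        convexOn_exp.2 (mem_univ _) (mem_univ _) (by linarith) (sq_nonneg y) (by ring)
    _ = 1 + (Real.exp (r ^ 2 / 2) - 1) * y ^ 2 := by
        simp only [smul_eq_mul, Real.exp_zero]
        ring

theorem rpow_add_add_rpow_sub_le {r w s : ℝ} (hr : 0 ≤ r) (hs : |s| ≤ w) (hw : 0 < w) :
    ((w + s) ^ r + (w - s) ^ r) / 2 ≤
      w ^ r + (Real.exp (r ^ 2 / 2) - 1) * (s ^ 2 / w * w ^ (r - 1)) := by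
  have hy : |s / w| ≤ 1 := by rwa [abs_div, abs_of_pos hw, div_le_one hw]
  obtain ⟨hy₁, hy₂⟩ := abs_le.1 hy
  have h := mul_le_mul_of_nonneg_right (rpow_one_add_add_rpow_one_sub_le hr hy)
    (Real.rpow_nonneg hw.le r)
  have hfac : w ^ r * (s / w) ^ 2 = s ^ 2 / w * w ^ (r - 1) := by
    rw [Real.rpow_sub_one hw.ne']
    field_simp
  have hadd : w + s = (1 + s / w) * w := by field_simp
  have hsub : w - s = (1 - s / w) * w := by field_simp
  rw [hadd, hsub, Real.mul_rpow (by linarith) hw.le, Real.mul_rpow (by linarith) hw.le, ← hfac]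
  linarith

theorem monotoneOn_rpow_sub_mul {p R : ℝ} (hp₁ : 1 < p) (hp₂ : p ≤ 2) :
    MonotoneOn (fun y ↦ p * y ^ (p - 1) - p * (p - 1) * R ^ (p - 2) * y) (Icc 0 R) := by
  intro y hy z hz hyz
  rcases hyz.eq_or_lt with rfl | hyz
  · exact le_rfl
  have hz_pos : 0 < z := hy.1.trans_lt hyz
  have hpow : R ^ (p - 2) ≤ z ^ (p - 2) := Real.rpow_le_rpow_of_nonpos hz_pos hz.2 (by linarith)
  have tangent := rpow_sub_one_mul_le_rpow_sub_rpow (b := p - 1) (by linarith) (by linarith)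
    hy.1 hz_pos
  rw [show p - 1 - 1 = p - 2 by ring] at tangent
  have hslope : (p - 1) * R ^ (p - 2) * (z - y) ≤ (p - 1) * z ^ (p - 2) * (z - y) := by
    have : 0 ≤ z - y := by linarith
    have : 0 ≤ p - 1 := by linarith
    gcongr
  have := mul_le_mul_of_nonneg_left (hslope.trans tangent) (zero_le_one.trans hp₁.le)
  linarith

theorem convexOn_abs_rpow_sub_sq {p R : ℝ} (hp₁ : 1 < p) (hp₂ : p ≤ 2) :
    ConvexOn ℝ (Icc (-R) R) fun y ↦ |y| ^ p - p * (p - 1) / 2 * R ^ (p - 2) * y ^ 2 := by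
  set g : ℝ → ℝ := fun y ↦ p * |y| ^ (p - 2) * y - p * (p - 1) * R ^ (p - 2) * y with hg
  have hderiv (y : ℝ) :
      HasDerivAt (fun y ↦ |y| ^ p - p * (p - 1) / 2 * R ^ (p - 2) * y ^ 2) (g y) y := by
    refine ((hasDerivAt_abs_rpow y hp₁).sub
      ((hasDerivAt_pow 2 y).const_mul (p * (p - 1) / 2 * R ^ (p - 2)))).congr_deriv ?_
    push_cast [hg]
    ring
  have hodd (y : ℝ) : g (-y) = -g y := by
    simp only [hg, abs_neg]
    ring
  have hmono_nonneg : MonotoneOn g (Icc 0 R) := by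
    refine (monotoneOn_rpow_sub_mul hp₁ hp₂).congr fun y hy ↦ ?_
    have hpow := rpow_sub_one_mul_self (sub_pos.2 hp₁).ne' hy.1
    simp only [hg, abs_of_nonneg hy.1, ← hpow]
    ring_nf
  have hmono : MonotoneOn g (Icc (-R) R) := by
    intro y hy z hz hyz
    rcases le_total 0 y with hy₀ | hy₀
    · exact hmono_nonneg ⟨hy₀, hy.2⟩ ⟨hy₀.trans hyz, hz.2⟩ hyz
    have hR : 0 ≤ R := by linarith [hy.1]
    have hg_zero : g 0 = 0 := by simp [hg]
    rcases le_total 0 z with hz₀ | hz₀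
    · have hgy := hmono_nonneg ⟨le_rfl, hR⟩ ⟨neg_nonneg.2 hy₀, neg_le.1 hy.1⟩ (neg_nonneg.2 hy₀)
      have hgz := hmono_nonneg ⟨le_rfl, hR⟩ ⟨hz₀, hz.2⟩ hz₀
      rw [hodd] at hgy
      linarith [hg_zero]
    · have hgyz := hmono_nonneg ⟨neg_nonneg.2 hz₀, neg_le.1 hz.1⟩
        ⟨neg_nonneg.2 hy₀, neg_le.1 hy.1⟩ (neg_le_neg hyz)
      rw [hodd, hodd] at hgyz
      linarith
  refine MonotoneOn.convexOn_of_deriv (convex_Icc _ _)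
    (fun y _ ↦ (hderiv y).continuousAt.continuousWithinAt)
    (fun y _ ↦ (hderiv y).differentiableAt.differentiableWithinAt) ?_
  rw [funext fun y ↦ (hderiv y).deriv]
  exact hmono.mono interior_subset

theorem abs_rpow_add_le_average {p R x d : ℝ} (hp₁ : 1 < p) (hp₂ : p ≤ 2)
    (hadd : |x + d| ≤ R) (hsub : |x - d| ≤ R) :
    |x| ^ p + p * (p - 1) / 2 * R ^ (p - 2) * d ^ 2 ≤ (|x + d| ^ p + |x - d| ^ p) / 2 := by
  have h := (convexOn_abs_rpow_sub_sq hp₁ hp₂).2 (abs_le.1 hadd) (abs_le.1 hsub)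
    (one_half_pos (α := ℝ)).le one_half_pos.le (by norm_num)
  simp only [smul_eq_mul] at h
  rw [show 1 / 2 * (x + d) + 1 / 2 * (x - d) = x by ring] at h
  linarith

end RealInequalities

section BellmanFunctions

/-- `B` is a supersolution for the pair consisting of a martingale and its square function: along
a symmetric step `x ↦ x ± d`, `t ↦ t + d²`, the value `B x t` does not increase on average. The
variable `t` stands for the square of the square function, and the growth is that of the `2r`-th
power of the maximum of `|x|` and `√t`. -/
structure IsBellmanFunction (r : ℝ) (B : ℝ → ℝ → ℝ) : Prop where
  measurable : Measurable (Function.uncurry B)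
  growth : ∃ C, ∀ x t, 0 ≤ t → |B x t| ≤ C * (x ^ 2 + t) ^ r
  average_le : ∀ x t d, 0 ≤ t → (B (x + d) (t + d ^ 2) + B (x - d) (t + d ^ 2)) / 2 ≤ B x t

theorem exists_average_rpow_le {r : ℝ} (hr : 0 < r) :
    ∃ C, 0 ≤ C ∧ ∀ x t d : ℝ, 0 ≤ t →
      (((x + d) ^ 2 + (t + d ^ 2)) ^ r + ((x - d) ^ 2 + (t + d ^ 2)) ^ r) / 2 ≤
        (x ^ 2 + t) ^ r + C * (d ^ 2 * (x ^ 2 + t + 2 * d ^ 2) ^ (r - 1)) := by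
  set A := Real.exp (r ^ 2 / 2) - 1 with hA
  have hA₀ : 0 ≤ A := by
    rw [hA, sub_nonneg]
    exact Real.one_le_exp (by positivity)
  refine ⟨4 * A + 2 * max 1 r, by positivity, fun x t d ht ↦ ?_⟩
  set w := x ^ 2 + t + 2 * d ^ 2 with hw
  rw [show (x + d) ^ 2 + (t + d ^ 2) = w + 2 * x * d by ring,
    show (x - d) ^ 2 + (t + d ^ 2) = w - 2 * x * d by ring]
  have hw₀ : 0 ≤ w := by positivity
  rcases hw₀.eq_or_lt with hw_zero | hw_pos
  · have hx : x = 0 := by nlinarith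
    have hd : d = 0 := by nlinarith
    have ht' : t = 0 := by nlinarith
    simp [hx, hd, ht', hw, Real.zero_rpow hr.ne']
  have hcross : |2 * x * d| ≤ w := by
    rw [abs_le]
    constructor <;> nlinarith [sq_nonneg (x + d), sq_nonneg (x - d), sq_nonneg d]
  have havg := rpow_add_add_rpow_sub_le hr.le hcross hw_pos
  have hincr := rpow_sub_rpow_le_max_mul hr (by positivity : 0 ≤ x ^ 2 + t)
    (by nlinarith [sq_nonneg d] : x ^ 2 + t ≤ w)
  have hsq : (2 * x * d) ^ 2 / w ≤ 4 * d ^ 2 := by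
    rw [div_le_iff₀ hw_pos]
    nlinarith [mul_nonneg (sq_nonneg d) (by nlinarith [sq_nonneg d] : 0 ≤ w - x ^ 2)]
  have hquad : A * ((2 * x * d) ^ 2 / w * w ^ (r - 1)) ≤ A * (4 * d ^ 2 * w ^ (r - 1)) := by
    gcongr
  have hwu : w - (x ^ 2 + t) = 2 * d ^ 2 := by ring
  rw [hwu] at hincr
  linarith

variable {r : ℝ}

theorem abs_rpow_sub_le {u a b C : ℝ} (ha₀ : 0 ≤ a) (ha : a ≤ u ^ r) (hb₀ : 0 ≤ b)
    (hb : b ≤ u ^ r) (hC : 0 ≤ C) : |a - C * b| ≤ (1 + C) * u ^ r := by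
  have : C * b ≤ C * u ^ r := by gcongr
  have : 0 ≤ C * b := by positivity
  have : 0 ≤ C * u ^ r := this.trans ‹_›
  exact abs_le.2 ⟨by linarith, by linarith⟩

/-- Dominates the square function by the martingale, for exponents `2r ∈ (1, 2]`. -/
theorem exists_isBellmanFunction_rpow_sub_abs_rpow (hr₁ : 1 / 2 < r) (hr₂ : r ≤ 1) :
    ∃ C, 0 ≤ C ∧ IsBellmanFunction r fun x t ↦ (x ^ 2 + t) ^ r - C * (x ^ 2) ^ r := by
  have hr : 0 < r := by linarith
  obtain ⟨A, hA, havg⟩ := exists_average_rpow_le hr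
  set c := 2 * r * (2 * r - 1) / 2 * 2 ^ (r - 1) with hc
  have hc_pos : 0 < c := by
    have : 0 < 2 * r - 1 := by linarith
    positivity
  refine ⟨A / c, by positivity, ⟨by fun_prop, ⟨1 + A / c, fun x t ht ↦ ?_⟩, fun x t d ht ↦ ?_⟩⟩
  · refine abs_rpow_sub_le (by positivity) le_rfl (by positivity) ?_ (by positivity)
    gcongr
    linarith
  set w := x ^ 2 + t + 2 * d ^ 2
  have hw₀ : 0 ≤ w := by positivity
  have habs (y : ℝ) : |y| ^ (2 * r) = (y ^ 2) ^ r := by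
    rw [Real.rpow_mul (abs_nonneg y), Real.rpow_two, sq_abs]
  have hconvex := abs_rpow_add_le_average (p := 2 * r) (R := √(2 * w)) (x := x) (d := d)
    (by linarith) (by linarith) (Real.abs_le_sqrt (by nlinarith [sq_nonneg (x - d)]))
    (Real.abs_le_sqrt (by nlinarith [sq_nonneg (x + d)]))
  rw [habs, habs, habs, show 2 * r - 2 = 2 * (r - 1) by ring, Real.rpow_mul (by positivity),
    Real.rpow_two, Real.sq_sqrt (by positivity), Real.mul_rpow (by norm_num) hw₀] at hconvex
  have hgain : A * (d ^ 2 * w ^ (r - 1)) ≤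
      A / c * ((((x + d) ^ 2) ^ r + ((x - d) ^ 2) ^ r) / 2 - (x ^ 2) ^ r) := by
    rw [div_mul_eq_mul_div, le_div_iff₀ hc_pos, mul_assoc]
    refine mul_le_mul_of_nonneg_left ?_ hA
    rw [hc]
    linarith
  have := havg x t d ht
  linarith

/-- Dominates the square function by the martingale, for exponents `2r ≥ 2`. -/
theorem isBellmanFunction_rpow_sub_sq_mul_rpow (hr : 1 ≤ r) :
    IsBellmanFunction r fun x t ↦ t ^ r - r * (x ^ 2 * t ^ (r - 1)) := by
  refine ⟨by fun_prop, ⟨1 + r, fun x t ht ↦ ?_⟩, fun x t d ht ↦ ?_⟩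
  · have htu : t ≤ x ^ 2 + t := by linarith [sq_nonneg x]
    exact abs_rpow_sub_le (by positivity) (by gcongr) (by positivity)
      (mul_rpow_sub_one_le_rpow hr (sq_nonneg x) ht (by linarith) htu) (by linarith)
  have tangent := mul_mul_rpow_sub_one_le hr ht (by positivity : 0 ≤ t + d ^ 2)
  have hpow := rpow_sub_one_mul_self (by linarith : r ≠ 0) (by positivity : 0 ≤ t + d ^ 2)
  have hmono : r * x ^ 2 * t ^ (r - 1) ≤ r * x ^ 2 * (t + d ^ 2) ^ (r - 1) := by
    have : 0 ≤ r - 1 := by linarith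
    gcongr
    linarith [sq_nonneg d]
  linear_combination tangent + hmono - r * hpow

/-- Dominates the martingale by the square function, for exponents `2r ≤ 2`. -/
theorem exists_isBellmanFunction_rpow_sub_rpow (hr₀ : 0 < r) (hr₁ : r ≤ 1) :
    ∃ C, 0 ≤ C ∧ IsBellmanFunction r fun x t ↦ (x ^ 2 + t) ^ r - C * t ^ r := by
  obtain ⟨A, hA, havg⟩ := exists_average_rpow_le hr₀
  refine ⟨A / r, by positivity, ⟨by fun_prop, ⟨1 + A / r, fun x t ht ↦ ?_⟩, fun x t d ht ↦ ?_⟩⟩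
  · have htu : t ≤ x ^ 2 + t := by linarith [sq_nonneg x]
    exact abs_rpow_sub_le (by positivity) le_rfl (by positivity) (by gcongr) (by positivity)
  have hgain : r * (d ^ 2 * (x ^ 2 + t + 2 * d ^ 2) ^ (r - 1)) ≤ (t + d ^ 2) ^ r - t ^ r := by
    rcases eq_or_ne d 0 with rfl | hd
    · simp
    have htd : 0 < t + d ^ 2 := by positivity
    calc r * (d ^ 2 * (x ^ 2 + t + 2 * d ^ 2) ^ (r - 1))
        ≤ r * (d ^ 2 * (t + d ^ 2) ^ (r - 1)) := by
          gcongr ?_ * (_ * ?_)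
          exact Real.rpow_le_rpow_of_nonpos htd (by nlinarith) (by linarith)
      _ = r * (t + d ^ 2) ^ (r - 1) * (t + d ^ 2 - t) := by ring
      _ ≤ (t + d ^ 2) ^ r - t ^ r := rpow_sub_one_mul_le_rpow_sub_rpow hr₀.le hr₁ ht htd
  have hgain' : A * (d ^ 2 * (x ^ 2 + t + 2 * d ^ 2) ^ (r - 1)) ≤
      A / r * ((t + d ^ 2) ^ r - t ^ r) := by
    rw [div_mul_eq_mul_div, le_div_iff₀ hr₀]
    linarith [mul_le_mul_of_nonneg_left hgain hA]
  linarith [havg x t d ht]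

/-- AM–GM: the average dominates the geometric mean, and
`((x + d)² + t + d²) ((x - d)² + t + d²) ≥ (x² + t)²`. -/
theorem rpow_le_average_rpow {ρ x t d : ℝ} (hρ : 0 ≤ ρ) (ht : 0 ≤ t) :
    (x ^ 2 + t) ^ ρ ≤ (((x + d) ^ 2 + (t + d ^ 2)) ^ ρ + ((x - d) ^ 2 + (t + d ^ 2)) ^ ρ) / 2 := by
  set a := (x + d) ^ 2 + (t + d ^ 2) with ha
  set b := (x - d) ^ 2 + (t + d ^ 2) with hb
  have ha₀ : 0 ≤ a := by positivity
  have hb₀ : 0 ≤ b := by positivity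
  have hu₀ : 0 ≤ x ^ 2 + t := by positivity
  have hab : (x ^ 2 + t) ^ 2 ≤ a * b := by
    rw [ha, hb]
    nlinarith [mul_nonneg ht (sq_nonneg d), sq_nonneg (d ^ 2)]
  have hprod : ((x ^ 2 + t) ^ ρ) ^ 2 ≤ a ^ ρ * b ^ ρ := by
    rw [← Real.mul_rpow ha₀ hb₀, Real.rpow_pow_comm hu₀]
    gcongr
  refine abs_le_of_sq_le_sq' ?_ (by positivity) |>.2
  nlinarith [sq_nonneg (a ^ ρ - b ^ ρ)]

theorem rpow_div_two_le_average_rpow {ρ x t d : ℝ} (hρ : 0 ≤ ρ) (ht : 0 ≤ t) :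
    (x ^ 2 + t + 2 * d ^ 2) ^ ρ / 2 ≤
      (((x + d) ^ 2 + (t + d ^ 2)) ^ ρ + ((x - d) ^ 2 + (t + d ^ 2)) ^ ρ) / 2 := by
  have hadd : 0 ≤ ((x + d) ^ 2 + (t + d ^ 2)) ^ ρ := by positivity
  have hsub : 0 ≤ ((x - d) ^ 2 + (t + d ^ 2)) ^ ρ := by positivity
  rcases le_total 0 (x * d) with hxd | hxd
  · have : (x ^ 2 + t + 2 * d ^ 2) ^ ρ ≤ ((x + d) ^ 2 + (t + d ^ 2)) ^ ρ :=
      Real.rpow_le_rpow (by positivity) (by linarith) hρ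
    linarith
  · have : (x ^ 2 + t + 2 * d ^ 2) ^ ρ ≤ ((x - d) ^ 2 + (t + d ^ 2)) ^ ρ :=
      Real.rpow_le_rpow (by positivity) (by linarith) hρ
    linarith

/-- Dominates the martingale by the square function, for exponents `2r ≥ 2`. -/
theorem exists_isBellmanFunction_rpow_sub_mul_rpow (hr : 1 ≤ r) :
    ∃ C, 0 ≤ C ∧
      IsBellmanFunction r fun x t ↦ (x ^ 2 + t) ^ r - C * (t * (x ^ 2 + t) ^ (r - 1)) := by
  obtain ⟨A, hA, havg⟩ := exists_average_rpow_le (zero_lt_one.trans_le hr)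
  refine ⟨2 * A, by positivity, ⟨by fun_prop, ⟨1 + 2 * A, fun x t ht ↦ ?_⟩, fun x t d ht ↦ ?_⟩⟩
  · have htu : t ≤ x ^ 2 + t := by linarith [sq_nonneg x]
    exact abs_rpow_sub_le (by positivity) le_rfl (by positivity)
      (mul_rpow_sub_one_le_rpow hr ht (by positivity) htu le_rfl) (by positivity)
  have hr' : 0 ≤ r - 1 := by linarith
  have hloss := mul_le_mul_of_nonneg_left (rpow_le_average_rpow (x := x) (d := d) hr' ht)
    (by positivity : 0 ≤ 2 * A * t)
  have hgain := mul_le_mul_of_nonneg_left (rpow_div_two_le_average_rpow (x := x) (d := d) hr' ht)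
    (by positivity : 0 ≤ 2 * A * d ^ 2)
  linarith [havg x t d ht]

theorem exists_isBellmanFunction_rpow_le (hr : 1 / 2 < r) :
    ∃ A C, 0 ≤ A ∧ 0 ≤ C ∧ ∃ B, IsBellmanFunction r B ∧
      ∀ x t, 0 ≤ t → t ^ r ≤ C * (x ^ 2) ^ r + A * B x t := by
  rcases le_total r 1 with hr₁ | hr₁
  · obtain ⟨C, hC, hB⟩ := exists_isBellmanFunction_rpow_sub_abs_rpow hr hr₁
    refine ⟨1, C, zero_le_one, hC, _, hB, fun x t ht ↦ ?_⟩
    have : t ^ r ≤ (x ^ 2 + t) ^ r :=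
      Real.rpow_le_rpow ht (by linarith [sq_nonneg x]) (by linarith)
    linarith
  · obtain ⟨C, hC, young⟩ := exists_mul_rpow_sub_one_le hr₁ r
    refine ⟨2, 2 * C, by norm_num, by positivity, _,
      isBellmanFunction_rpow_sub_sq_mul_rpow hr₁, fun x t ht ↦ ?_⟩
    linarith [young (x ^ 2) t (sq_nonneg x) ht]

theorem exists_isBellmanFunction_sq_rpow_le (hr : 0 < r) :
    ∃ A C, 0 ≤ A ∧ 0 ≤ C ∧ ∃ B, IsBellmanFunction r B ∧
      ∀ x t, 0 ≤ t → (x ^ 2) ^ r ≤ C * t ^ r + A * B x t := by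
  have hle (x t : ℝ) (ht : 0 ≤ t) : (x ^ 2) ^ r ≤ (x ^ 2 + t) ^ r := by
    gcongr
    linarith
  rcases le_total r 1 with hr₁ | hr₁
  · obtain ⟨C, hC, hB⟩ := exists_isBellmanFunction_rpow_sub_rpow hr hr₁
    exact ⟨1, C, zero_le_one, hC, _, hB, fun x t ht ↦ by linarith [hle x t ht]⟩
  · obtain ⟨A, -, hB⟩ := exists_isBellmanFunction_rpow_sub_mul_rpow hr₁
    obtain ⟨C, hC, young⟩ := exists_mul_rpow_sub_one_le hr₁ A
    exact ⟨2, 2 * C, by norm_num, by positivity, _, hB, fun x t ht ↦ by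
      linarith [hle x t ht, young t (x ^ 2 + t) ht (by positivity)]⟩

end BellmanFunctions

section SymmetricMartingales

open Filter Topology

variable {Ω : Type*} {m : MeasurableSpace Ω} {μ : Measure Ω} {p : ℝ≥0∞} {ℱ : Filtration ℤ m}
  {f : ℤ → Ω → ℝ} {B : ℝ → ℝ → ℝ}

/-- An `L^p` martingale, indexed by `ℤ`, the size of whose increments is predictable, as it is for
dyadic martingales: given the past, an increment takes two opposite values. The martingale property
is expressed by the orthogonality of each increment to the past, which makes sense also where `μ`
is infinite. -/
structure IsSymmetricMartingale (μ : Measure Ω) (p : ℝ≥0∞) (ℱ : Filtration ℤ m)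
    (f : ℤ → Ω → ℝ) : Prop where
  memLp : ∀ n, MemLp (f n) p μ
  measurable : ∀ n, Measurable[ℱ n] (f n)
  measurable_abs_sub : ∀ n, Measurable[ℱ n] fun x ↦ |f (n + 1) x - f n x|
  integral_mul_sub_eq_zero : ∀ (n : ℤ) (v : Ω → ℝ), Measurable[ℱ n] v →
    Integrable (fun x ↦ v x * (f (n + 1) x - f n x)) μ →
    ∫ x, v x * (f (n + 1) x - f n x) ∂μ = 0

/-- The sum of the squared increments of `f` between the times `a` and `b`. -/
def squareSum (f : ℤ → Ω → ℝ) (a b : ℤ) (x : Ω) : ℝ :=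
  ∑ i ∈ Finset.Ico a b, (f (i + 1) x - f i x) ^ 2

theorem squareSum_nonneg (a b : ℤ) (x : Ω) : 0 ≤ squareSum f a b x :=
  Finset.sum_nonneg fun _ _ ↦ sq_nonneg _

theorem squareSum_add_one {a b : ℤ} (hab : a ≤ b) (x : Ω) :
    squareSum f a (b + 1) x = squareSum f a b x + (f (b + 1) x - f b x) ^ 2 := by
  rw [squareSum, squareSum, ← Finset.insert_Ico_right_eq_Ico_add_one hab,
    Finset.sum_insert (by simp), add_comm]

/-- The square function of a process indexed by `ℤ`, with values in `[0, ∞]`. -/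
def squareFunction (f : ℤ → Ω → ℝ) (x : Ω) : ℝ≥0∞ :=
  (∑' i : ℤ, ENNReal.ofReal ((f (i + 1) x - f i x) ^ 2)) ^ (1 / 2 : ℝ)

theorem ofReal_sqrt_squareSum (f : ℤ → Ω → ℝ) (a b : ℤ) (x : Ω) :
    ENNReal.ofReal √(squareSum f a b x) =
      (∑ i ∈ Finset.Ico a b, ENNReal.ofReal ((f (i + 1) x - f i x) ^ 2)) ^ (1 / 2 : ℝ) := by
  rw [Real.sqrt_eq_rpow, ← ENNReal.ofReal_rpow_of_nonneg (squareSum_nonneg a b x) (by positivity),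
    squareSum, ENNReal.ofReal_sum_of_nonneg fun _ _ ↦ sq_nonneg _]

theorem ofReal_sqrt_squareSum_le (f : ℤ → Ω → ℝ) (a b : ℤ) (x : Ω) :
    ENNReal.ofReal √(squareSum f a b x) ≤ squareFunction f x := by
  rw [ofReal_sqrt_squareSum, squareFunction]
  gcongr
  exact ENNReal.sum_le_tsum _

theorem tendsto_ofReal_sqrt_squareSum (f : ℤ → Ω → ℝ) (x : Ω) :
    Tendsto (fun N : ℕ ↦ ENNReal.ofReal √(squareSum f (-N) N x)) atTop
      (𝓝 (squareFunction f x)) := by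
  simp only [ofReal_sqrt_squareSum]
  exact (ENNReal.summable.hasSum.comp (Finset.tendsto_Ico_neg (R := ℤ))).ennrpow_const _

theorem norm_rpow_eq_sq_rpow_half (y : ℝ) : ‖y‖ ^ p.toReal = (y ^ 2) ^ (p / 2).toReal := by
  rw [ENNReal.toReal_div, ENNReal.toReal_ofNat, ← sq_abs, ← Real.rpow_two,
    ← Real.rpow_mul (abs_nonneg y), mul_div_cancel₀ _ two_ne_zero, Real.norm_eq_abs]

theorem memLp_sq {g : Ω → ℝ} (hg : MemLp g p μ) : MemLp (fun x ↦ g x ^ 2) (p / 2) μ := by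
  simpa using hg.norm_rpow_div 2

theorem integrable_sq_rpow (hp₀ : p ≠ 0) (hp : p ≠ ∞) {g : Ω → ℝ} (hg : MemLp g p μ) :
    Integrable (fun x ↦ (g x ^ 2) ^ (p / 2).toReal) μ := by
  refine (hg.integrable_norm_rpow hp₀ hp).congr (.of_forall fun x ↦ ?_)
  exact norm_rpow_eq_sq_rpow_half (g x)

theorem eLpNorm_le_of_integral_rpow_le (hp₀ : p ≠ 0) (hp : p ≠ ∞) {g h : Ω → ℝ}
    (hg : MemLp g p μ) (hh : MemLp h p μ) {C : ℝ} (hC : 0 ≤ C)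
    (hle : ∫ x, (g x ^ 2) ^ (p / 2).toReal ∂μ ≤ C * ∫ x, (h x ^ 2) ^ (p / 2).toReal ∂μ) :
    eLpNorm g p μ ≤ (C ^ p.toReal⁻¹).toNNReal * eLpNorm h p μ := by
  simp only [← norm_rpow_eq_sq_rpow_half] at hle
  have hint_nonneg : 0 ≤ ∫ x, ‖h x‖ ^ p.toReal ∂μ := integral_nonneg fun x ↦ by positivity
  rw [hg.eLpNorm_eq_integral_rpow_norm hp₀ hp, hh.eLpNorm_eq_integral_rpow_norm hp₀ hp,
    ← ENNReal.ofReal, ← ENNReal.ofReal_mul (by positivity), ← Real.mul_rpow hC hint_nonneg]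
  have : 0 ≤ ∫ x, ‖g x‖ ^ p.toReal ∂μ := integral_nonneg fun x ↦ by positivity
  gcongr

theorem IsBellmanFunction.integrable_comp (hp₀ : p ≠ 0) (hp : p ≠ ∞)
    (hB : IsBellmanFunction (p / 2).toReal B) {g s : Ω → ℝ} (hg : MemLp g p μ)
    (hs : MemLp s (p / 2) μ) (hs₀ : ∀ x, 0 ≤ s x) :
    Integrable (fun x ↦ B (g x) (s x)) μ := by
  obtain ⟨C, hC⟩ := hB.growth
  have henergy := ((memLp_sq hg).add hs).integrable_norm_rpow
    (ENNReal.div_ne_zero.2 ⟨hp₀, ENNReal.ofNat_ne_top⟩) (ENNReal.div_ne_top hp two_ne_zero)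
  refine (henergy.const_mul C).mono' ?_ (.of_forall fun x ↦ (hC _ _ (hs₀ x)).trans_eq ?_)
  · exact (hB.measurable.comp_aemeasurable
      (hg.1.aemeasurable.prodMk hs.1.aemeasurable)).aestronglyMeasurable
  · rw [Pi.add_apply, Real.norm_of_nonneg (add_nonneg (sq_nonneg _) (hs₀ x))]

theorem IsBellmanFunction.measurable_slope {r : ℝ} (hB : IsBellmanFunction r B)
    {g s d : Ω → ℝ} (hg : Measurable g) (hs : Measurable s) (hd : Measurable d) :
    Measurable fun x ↦
      (B (g x + d x) (s x + d x ^ 2) - B (g x - d x) (s x + d x ^ 2)) / 2 / d x := by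
  have hadd := hB.measurable.comp ((hg.add hd).prodMk (hs.add (hd.pow_const 2)))
  have hsub := hB.measurable.comp ((hg.sub hd).prodMk (hs.add (hd.pow_const 2)))
  exact ((hadd.sub hsub).div_const 2).div hd

theorem eLpNorm_le_of_tendsto {f : ℕ → Ω → ℝ≥0∞} {g : Ω → ℝ≥0∞} {C : ℝ≥0∞}
    (hf : ∀ n, AEMeasurable (f n) μ) (hfg : ∀ x, Tendsto (f · x) atTop (𝓝 (g x)))
    (hp₀ : p ≠ 0) (hp : p ≠ ∞) (hC : ∀ n, eLpNorm (f n) p μ ≤ C) : eLpNorm g p μ ≤ C := by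
  have hr : 0 < p.toReal := ENNReal.toReal_pos hp₀ hp
  simp only [eLpNorm_eq_lintegral_rpow_enorm_toReal hp₀ hp, enorm_eq_self, one_div,
    ENNReal.rpow_inv_le_iff hr] at hC ⊢
  calc ∫⁻ x, g x ^ p.toReal ∂μ
      = ∫⁻ x, liminf (fun n ↦ f n x ^ p.toReal) atTop ∂μ :=
        lintegral_congr fun x ↦ ((hfg x).ennrpow_const _).liminf_eq.symm
    _ ≤ liminf (fun n ↦ ∫⁻ x, f n x ^ p.toReal ∂μ) atTop :=
        lintegral_liminf_le' fun n ↦ (hf n).pow_const _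
    _ ≤ C ^ p.toReal :=
        (liminf_le_liminf (.of_forall hC)).trans (liminf_const _).le

namespace IsSymmetricMartingale

theorem memLp_sub (hf : IsSymmetricMartingale μ p ℱ f) (a b : ℤ) :
    MemLp (fun x ↦ f b x - f a x) p μ :=
  (hf.memLp b).sub (hf.memLp a)

theorem memLp_squareSum (hf : IsSymmetricMartingale μ p ℱ f) (a b : ℤ) :
    MemLp (squareSum f a b) (p / 2) μ :=
  memLp_finsetSum _ fun i _ ↦ memLp_sq (hf.memLp_sub i (i + 1))

theorem measurable_squareSum (hf : IsSymmetricMartingale μ p ℱ f) (a b : ℤ) :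
    Measurable[ℱ b] (squareSum f a b) := by
  refine Finset.measurable_sum (m := ℱ b) _ fun i hi ↦ Measurable.pow_const ?_ 2
  obtain ⟨-, hib⟩ := Finset.mem_Ico.1 hi
  exact ((hf.measurable (i + 1)).mono (ℱ.mono (by lia)) le_rfl).sub
    ((hf.measurable i).mono (ℱ.mono hib.le) le_rfl)

/-- The part of `B (f (n + 1) - f a)` that is odd in the increment `d = f (n + 1) - f n` is `d`
times a function of the past and of `|d|`, so that its integral vanishes. -/
theorem integral_odd_part_eq_zero (hf : IsSymmetricMartingale μ p ℱ f)
    (hB : IsBellmanFunction (p / 2).toReal B) {n : ℤ} {g s : Ω → ℝ} (hg : Measurable[ℱ n] g)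
    (hs : Measurable[ℱ n] s)
    (hint : Integrable (fun x ↦
      (B (g x + (f (n + 1) x - f n x)) (s x + (f (n + 1) x - f n x) ^ 2) -
        B (g x - (f (n + 1) x - f n x)) (s x + (f (n + 1) x - f n x) ^ 2)) / 2) μ) :
    ∫ x, (B (g x + (f (n + 1) x - f n x)) (s x + (f (n + 1) x - f n x) ^ 2) -
      B (g x - (f (n + 1) x - f n x)) (s x + (f (n + 1) x - f n x) ^ 2)) / 2 ∂μ = 0 := by
  have hslope := hB.measurable_slope hg hs (hf.measurable_abs_sub n)
  have hodd (x t d : ℝ) : (B (x + |d|) (t + |d| ^ 2) - B (x - |d|) (t + |d| ^ 2)) / 2 / |d| * d =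
      (B (x + d) (t + d ^ 2) - B (x - d) (t + d ^ 2)) / 2 := by
    rw [sq_abs]
    rcases lt_trichotomy d 0 with hd | rfl | hd
    · rw [abs_of_neg hd, sub_neg_eq_add, ← sub_eq_add_neg]
      field_simp [hd.ne]
      ring
    · simp
    · rw [abs_of_pos hd]
      field_simp
  refine (integral_congr_ae (.of_forall fun x ↦ (hodd _ _ _).symm)).trans
    (hf.integral_mul_sub_eq_zero n _ hslope (hint.congr (.of_forall fun x ↦ (hodd _ _ _).symm)))

theorem integral_bellman_add_one_le (hf : IsSymmetricMartingale μ p ℱ f) (hp₀ : p ≠ 0)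
    (hp : p ≠ ∞) (hB : IsBellmanFunction (p / 2).toReal B) {a n : ℤ} (han : a ≤ n) :
    ∫ x, B (f (n + 1) x - f a x) (squareSum f a (n + 1) x) ∂μ ≤
      ∫ x, B (f n x - f a x) (squareSum f a n x) ∂μ := by
  set g : Ω → ℝ := fun x ↦ f n x - f a x
  set s := squareSum f a n
  set d : Ω → ℝ := fun x ↦ f (n + 1) x - f n x
  set u : Ω → ℝ := fun x ↦ B (g x + d x) (s x + d x ^ 2)
  set v : Ω → ℝ := fun x ↦ B (g x - d x) (s x + d x ^ 2)
  have hs₀ : ∀ x, 0 ≤ s x := squareSum_nonneg a n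
  have hg : MemLp g p μ := hf.memLp_sub a n
  have hd : MemLp d p μ := hf.memLp_sub n (n + 1)
  have hs : MemLp s (p / 2) μ := hf.memLp_squareSum a n
  have hsd : MemLp (fun x ↦ s x + d x ^ 2) (p / 2) μ := hs.add (memLp_sq hd)
  have hsd₀ (x : Ω) : 0 ≤ s x + d x ^ 2 := add_nonneg (hs₀ x) (sq_nonneg _)
  have hu : Integrable u μ := hB.integrable_comp hp₀ hp (hg.add hd) hsd hsd₀
  have hv : Integrable v μ := hB.integrable_comp hp₀ hp (hg.sub hd) hsd hsd₀
  have heven : Integrable (fun x ↦ (u x + v x) / 2) μ := (hu.add hv).div_const 2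
  have hodd : Integrable (fun x ↦ (u x - v x) / 2) μ := (hu.sub hv).div_const 2
  have hodd_zero : ∫ x, (u x - v x) / 2 ∂μ = 0 :=
    hf.integral_odd_part_eq_zero hB
      ((hf.measurable n).sub ((hf.measurable a).mono (ℱ.mono han) le_rfl))
      (hf.measurable_squareSum a n) hodd
  calc ∫ x, B (f (n + 1) x - f a x) (squareSum f a (n + 1) x) ∂μ
      = ∫ x, (u x + v x) / 2 + (u x - v x) / 2 ∂μ := by
        congr with x
        rw [squareSum_add_one han, show f (n + 1) x - f a x = g x + d x by ring]
        ring
    _ = ∫ x, (u x + v x) / 2 ∂μ := by rw [integral_add heven hodd, hodd_zero, add_zero]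
    _ ≤ ∫ x, B (g x) (s x) ∂μ :=
        integral_mono heven (hB.integrable_comp hp₀ hp hg hs hs₀)
          fun x ↦ hB.average_le _ _ _ (hs₀ x)

theorem integral_bellman_nonpos (hf : IsSymmetricMartingale μ p ℱ f) (hp₀ : p ≠ 0) (hp : p ≠ ∞)
    (hB : IsBellmanFunction (p / 2).toReal B) {a b : ℤ} (hab : a ≤ b) :
    ∫ x, B (f b x - f a x) (squareSum f a b x) ∂μ ≤ 0 := by
  induction b, hab using Int.leInduction with
  | base =>
    obtain ⟨C, hC⟩ := hB.growth
    have hr : (p / 2).toReal ≠ 0 := by simp [ENNReal.toReal_eq_zero_iff, hp₀, hp]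
    have hB₀ : B 0 0 = 0 := by
      have := hC 0 0 le_rfl
      rwa [sq, zero_mul, add_zero, Real.zero_rpow hr, mul_zero, abs_nonpos_iff] at this
    simp [squareSum, hB₀]
  | succ n han ih => exact (hf.integral_bellman_add_one_le hp₀ hp hB han).trans ih

theorem integral_le_of_bellman (hf : IsSymmetricMartingale μ p ℱ f) (hp₀ : p ≠ 0) (hp : p ≠ ∞)
    (hB : IsBellmanFunction (p / 2).toReal B) {a b : ℤ} (hab : a ≤ b) {A C : ℝ} (hA : 0 ≤ A)
    {g h : Ω → ℝ} (hg : Integrable g μ) (hh : Integrable h μ)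
    (hle : ∀ x, g x ≤ C * h x + A * B (f b x - f a x) (squareSum f a b x)) :
    ∫ x, g x ∂μ ≤ C * ∫ x, h x ∂μ := by
  have hBint := hB.integrable_comp hp₀ hp (hf.memLp_sub a b) (hf.memLp_squareSum a b)
    (squareSum_nonneg a b)
  have hmono := integral_mono hg ((hh.const_mul C).add (hBint.const_mul A)) hle
  simp only [Pi.add_apply] at hmono
  rw [integral_add (hh.const_mul C) (hBint.const_mul A), integral_const_mul,
    integral_const_mul] at hmono
  have := mul_nonpos_of_nonneg_of_nonpos hA (hf.integral_bellman_nonpos hp₀ hp hB hab)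
  linarith

theorem memLp_sqrt_squareSum (hf : IsSymmetricMartingale μ p ℱ f) (a b : ℤ) :
    MemLp (fun x ↦ √(squareSum f a b x)) p μ := by
  have h := (hf.memLp_squareSum a b).norm_rpow_div 2⁻¹
  have hexp : p / 2 / 2⁻¹ = p := by
    rw [div_eq_mul_inv _ 2⁻¹, inv_inv, ENNReal.div_mul_cancel two_ne_zero ENNReal.ofNat_ne_top]
  rw [hexp] at h
  refine h.ae_eq (.of_forall fun x ↦ ?_)
  simp [Real.sqrt_eq_rpow, abs_of_nonneg (squareSum_nonneg a b x)]

variable (μ ℱ) in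
theorem exists_eLpNorm_sqrt_squareSum_le (hp₁ : 1 < p) (hp : p ≠ ∞) :
    ∃ C : ℝ≥0, ∀ f, IsSymmetricMartingale μ p ℱ f → ∀ a b, a ≤ b →
      eLpNorm (fun x ↦ √(squareSum f a b x)) p μ ≤ C * eLpNorm (fun x ↦ f b x - f a x) p μ := by
  have hp₀ : p ≠ 0 := (zero_lt_one.trans hp₁).ne'
  have hr : 1 / 2 < (p / 2).toReal := by
    rw [ENNReal.toReal_div, ENNReal.toReal_ofNat]
    gcongr
    simpa using ENNReal.toReal_strict_mono hp hp₁
  obtain ⟨A, C, hA, hC, B, hB, hle⟩ := exists_isBellmanFunction_rpow_le hr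
  refine ⟨_, fun f hf a b hab ↦ eLpNorm_le_of_integral_rpow_le hp₀ hp
    (hf.memLp_sqrt_squareSum a b) (hf.memLp_sub a b) hC ?_⟩
  refine hf.integral_le_of_bellman hp₀ hp hB hab hA
    (integrable_sq_rpow hp₀ hp (hf.memLp_sqrt_squareSum a b))
    (integrable_sq_rpow hp₀ hp (hf.memLp_sub a b)) fun x ↦ ?_
  rw [Real.sq_sqrt (squareSum_nonneg a b x)]
  exact hle _ _ (squareSum_nonneg a b x)

variable (μ ℱ) in
theorem exists_eLpNorm_sub_le (hp₀ : p ≠ 0) (hp : p ≠ ∞) :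
    ∃ C : ℝ≥0, ∀ f, IsSymmetricMartingale μ p ℱ f → ∀ a b, a ≤ b →
      eLpNorm (fun x ↦ f b x - f a x) p μ ≤ C * eLpNorm (fun x ↦ √(squareSum f a b x)) p μ := by
  have hr : 0 < (p / 2).toReal := ENNReal.toReal_pos
    (ENNReal.div_ne_zero.2 ⟨hp₀, ENNReal.ofNat_ne_top⟩) (ENNReal.div_ne_top hp two_ne_zero)
  obtain ⟨A, C, hA, hC, B, hB, hle⟩ := exists_isBellmanFunction_sq_rpow_le hr
  refine ⟨_, fun f hf a b hab ↦ eLpNorm_le_of_integral_rpow_le hp₀ hp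
    (hf.memLp_sub a b) (hf.memLp_sqrt_squareSum a b) hC ?_⟩
  refine hf.integral_le_of_bellman hp₀ hp hB hab hA
    (integrable_sq_rpow hp₀ hp (hf.memLp_sub a b))
    (integrable_sq_rpow hp₀ hp (hf.memLp_sqrt_squareSum a b)) fun x ↦ ?_
  rw [Real.sq_sqrt (squareSum_nonneg a b x)]
  exact hle _ _ (squareSum_nonneg a b x)

variable (μ ℱ) in
theorem exists_eLpNorm_squareFunction_le (hp₁ : 1 < p) (hp : p ≠ ∞) :
    ∃ C : ℝ≥0, ∀ f, IsSymmetricMartingale μ p ℱ f → ∀ M, (∀ n, eLpNorm (f n) p μ ≤ M) →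
      eLpNorm (squareFunction f) p μ ≤ C * M := by
  have hp₀ : p ≠ 0 := (zero_lt_one.trans hp₁).ne'
  obtain ⟨C, hC⟩ := exists_eLpNorm_sqrt_squareSum_le μ ℱ hp₁ hp
  refine ⟨C * 2, fun f hf M hM ↦ ?_⟩
  have hmeas (N : ℕ) : AEMeasurable
      (fun x ↦ ENNReal.ofReal √(squareSum f (-N) N x)) μ :=
    (hf.memLp_sqrt_squareSum (-N) N).1.aemeasurable.ennreal_ofReal
  refine eLpNorm_le_of_tendsto hmeas (tendsto_ofReal_sqrt_squareSum f) hp₀ hp fun N ↦ ?_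
  calc eLpNorm (fun x ↦ ENNReal.ofReal √(squareSum f (-N) N x)) p μ
      = eLpNorm (fun x ↦ √(squareSum f (-N) N x)) p μ := eLpNorm_congr_enorm_ae
        (.of_forall fun x ↦ by rw [enorm_eq_self, Real.enorm_of_nonneg (Real.sqrt_nonneg _)])
    _ ≤ C * eLpNorm (fun x ↦ f N x - f (-N) x) p μ := hC f hf _ _ (by lia)
    _ ≤ C * (M + M) := by
        gcongr
        refine (eLpNorm_sub_le (hf.memLp _).1 (hf.memLp _).1 hp₁.le).trans ?_
        gcongr <;> exact hM _
    _ = ↑(C * 2) * M := by rw [← two_mul, ENNReal.coe_mul, mul_assoc, ENNReal.coe_ofNat]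

variable (μ ℱ) in
theorem exists_eLpNorm_limit_le (hp₀ : p ≠ 0) (hp : p ≠ ∞) :
    ∃ C : ℝ≥0, ∀ f, IsSymmetricMartingale μ p ℱ f → ∀ g : Ω → ℝ,
      (∀ᵐ x ∂μ, Tendsto (fun N : ℕ ↦ f N x) atTop (𝓝 (g x))) →
      (∀ᵐ x ∂μ, Tendsto (fun N : ℕ ↦ f (-N) x) atTop (𝓝 0)) →
      eLpNorm g p μ ≤ C * eLpNorm (squareFunction f) p μ := by
  obtain ⟨C, hC⟩ := exists_eLpNorm_sub_le μ ℱ hp₀ hp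
  refine ⟨C, fun f hf g hg h₀ ↦ Lp.eLpNorm_le_of_ae_tendsto (u := atTop)
    (f := fun (N : ℕ) x ↦ f N x - f (-N) x) (.of_forall fun N ↦ ?_)
    (fun N ↦ (hf.memLp_sub (-N) N).1) ?_⟩
  · refine (hC f hf _ _ (by lia)).trans ?_
    gcongr
    refine eLpNorm_mono_enorm fun x ↦ ?_
    rw [enorm_eq_self, Real.enorm_of_nonneg (Real.sqrt_nonneg _)]
    exact ofReal_sqrt_squareSum_le _ _ _ _
  · filter_upwards [hg, h₀] with x hgx h₀x
    simpa only [sub_zero] using hgx.sub h₀x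

end IsSymmetricMartingale

end SymmetricMartingales

section DyadicIntervals

theorem ae_posVolume_nonneg : ∀ᵐ x ∂posVolume, 0 ≤ x := ae_restrict_mem measurableSet_Ici

/-- The index `k` of the dyadic interval `I^n_k` that contains `x ≥ 0`. -/
def dyadicIndex (n : ℤ) (x : ℝ) : ℕ := ⌊(2 : ℝ) ^ n * x⌋₊

variable {n j : ℤ} {k : ℕ} {x y : ℝ}

theorem mem_dyadicInterval_iff : x ∈ dyadicInterval n k ↔ 0 ≤ x ∧ dyadicIndex n x = k := by
  have h2 : (0 : ℝ) < 2 ^ n := by positivity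
  have key : x ∈ dyadicInterval n k ↔ (k : ℝ) ≤ 2 ^ n * x ∧ 2 ^ n * x < k + 1 := by
    rw [dyadicInterval, mem_Ico, zpow_neg, ← div_eq_mul_inv, ← div_eq_mul_inv, div_le_iff₀ h2,
      lt_div_iff₀ h2, mul_comm x]
  rw [key]
  refine ⟨fun h ↦ ?_, fun ⟨hx, h⟩ ↦ (Nat.floor_eq_iff (by positivity)).1 h⟩
  have hx : 0 ≤ x := nonneg_of_mul_nonneg_right (k.cast_nonneg.trans h.1) h2
  exact ⟨hx, (Nat.floor_eq_iff (by positivity)).2 h⟩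

theorem mem_dyadicInterval_dyadicIndex (n : ℤ) (hx : 0 ≤ x) :
    x ∈ dyadicInterval n (dyadicIndex n x) :=
  mem_dyadicInterval_iff.2 ⟨hx, rfl⟩

theorem dyadicIndex_eq_div (n : ℤ) (x : ℝ) : dyadicIndex n x = dyadicIndex (n + 1) x / 2 := by
  rw [dyadicIndex, dyadicIndex, ← Nat.floor_div_ofNat, zpow_add_one₀ two_ne_zero]
  congr 1
  ring

theorem dyadicIndex_eq_of_le (hjn : j ≤ n) (h : dyadicIndex n x = dyadicIndex n y) :
    dyadicIndex j x = dyadicIndex j y := by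
  induction j, hjn using Int.leInductionDown with
  | base => exact h
  | pred i _ ih =>
    rw [dyadicIndex_eq_div, dyadicIndex_eq_div (i - 1), sub_add_cancel, ih]

theorem measurable_dyadicIndex (n : ℤ) : Measurable (dyadicIndex n) :=
  Nat.measurable_floor.comp (measurable_const_mul _)

theorem measurableSet_dyadicInterval (n : ℤ) (k : ℕ) : MeasurableSet (dyadicInterval n k) :=
  measurableSet_Ico

theorem dyadicInterval_subset_Ici (n : ℤ) (k : ℕ) : dyadicInterval n k ⊆ Ici 0 :=
  fun _ hx ↦ (mem_dyadicInterval_iff.1 hx).1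

theorem posVolume_restrict_dyadicInterval (n : ℤ) (k : ℕ) :
    posVolume.restrict (dyadicInterval n k) = volume.restrict (dyadicInterval n k) := by
  rw [posVolume, Measure.restrict_restrict (measurableSet_dyadicInterval n k),
    inter_eq_left.2 (dyadicInterval_subset_Ici n k)]

theorem posVolume_dyadicInterval (n : ℤ) (k : ℕ) :
    posVolume (dyadicInterval n k) = ENNReal.ofReal (2 ^ (-n)) := by
  rw [← Measure.restrict_apply_self, posVolume_restrict_dyadicInterval,
    Measure.restrict_apply_self, ← volume_real_dyadicInterval n k,
    ofReal_measureReal (by simp [dyadicInterval])]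

instance (n : ℤ) (k : ℕ) : IsFiniteMeasure (posVolume.restrict (dyadicInterval n k)) :=
  ⟨by rw [Measure.restrict_apply_univ, posVolume_dyadicInterval]; exact ENNReal.ofReal_lt_top⟩

theorem pairwise_disjoint_dyadicInterval (n : ℤ) :
    Pairwise (Function.onFun Disjoint (dyadicInterval n)) := fun i j hij ↦ by
  refine Set.disjoint_left.2 fun x hi hj ↦ hij ?_
  rw [← (mem_dyadicInterval_iff.1 hi).2, (mem_dyadicInterval_iff.1 hj).2]

theorem posVolume_eq_sum_restrict (n : ℤ) :
    posVolume = Measure.sum fun k ↦ posVolume.restrict (dyadicInterval n k) := by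
  have hunion : ⋃ k, dyadicInterval n k = Ici 0 := by
    ext x
    simp [mem_dyadicInterval_iff]
  rw [← Measure.restrict_iUnion (pairwise_disjoint_dyadicInterval n)
    (measurableSet_dyadicInterval n), hunion, posVolume,
    Measure.restrict_restrict measurableSet_Ici, inter_self]

theorem dyadicInterval_eq_union (n : ℤ) (k : ℕ) : dyadicInterval n k =
    dyadicInterval (n + 1) (2 * k) ∪ dyadicInterval (n + 1) (2 * k + 1) := by
  ext x
  simp only [mem_union, mem_dyadicInterval_iff, dyadicIndex_eq_div n x, ← and_or_left]
  refine and_congr_right fun _ ↦ ?_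
  lia

/-- A function on `ℝ⁺` that is integrable on every dyadic interval. -/
def DyadicIntegrable (f : ℝ → ℝ) : Prop :=
  ∀ n k, IntegrableOn f (dyadicInterval n k) posVolume

variable {f g u : ℝ → ℝ} {p : ℝ≥0∞}

theorem dyadicIntegrable_of_memLp (hp : 1 ≤ p) (hf : MemLp f p posVolume) : DyadicIntegrable f :=
  fun _ _ ↦ (hf.restrict _).integrable hp

theorem DyadicIntegrable.setIntegral_eq_add (hf : DyadicIntegrable f) (n : ℤ) (k : ℕ) :
    ∫ y in dyadicInterval n k, f y ∂posVolume =
      ∫ y in dyadicInterval (n + 1) (2 * k), f y ∂posVolume +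
        ∫ y in dyadicInterval (n + 1) (2 * k + 1), f y ∂posVolume := by
  rw [dyadicInterval_eq_union, setIntegral_union
    (pairwise_disjoint_dyadicInterval (n + 1) (by lia))
    (measurableSet_dyadicInterval _ _) (hf _ _) (hf _ _)]

/-- The filtration generated by the dyadic intervals, indexed by their levels. -/
def dyadicFiltration : Filtration ℤ Real.measurableSpace where
  seq n := MeasurableSpace.comap (dyadicIndex n) ⊤
  mono' := monotone_int_of_le_succ fun n ↦ by
    have h : dyadicIndex n = (· / 2) ∘ dyadicIndex (n + 1) := funext (dyadicIndex_eq_div n)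
    rw [h, ← MeasurableSpace.comap_comp]
    exact MeasurableSpace.comap_mono le_top
  le' n := (measurable_dyadicIndex n).comap_le

theorem measurable_comp_dyadicIndex (c : ℕ → ℝ) (n : ℤ) :
    Measurable[dyadicFiltration n] fun x ↦ c (dyadicIndex n x) :=
  measurable_from_top.comp (comap_measurable (dyadicIndex n))

theorem eq_of_measurable_dyadicFiltration (hu : Measurable[dyadicFiltration n] u)
    (h : dyadicIndex n x = dyadicIndex n y) : u x = u y :=
  hu.factorsThrough h

theorem exists_eqOn_const_dyadicInterval (hu : Measurable[dyadicFiltration n] u) (k : ℕ) :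
    ∃ c, EqOn u (fun _ ↦ c) (dyadicInterval n k) := by
  obtain h | ⟨x, hx⟩ := (dyadicInterval n k).eq_empty_or_nonempty
  · exact ⟨0, by simp [h]⟩
  · refine ⟨u x, fun y hy ↦ eq_of_measurable_dyadicFiltration hu ?_⟩
    rw [(mem_dyadicInterval_iff.1 hx).2, (mem_dyadicInterval_iff.1 hy).2]

theorem dyadicIntegrable_of_measurable (hu : Measurable[dyadicFiltration n] u) :
    DyadicIntegrable u := by
  have hfine (j : ℤ) (hnj : n ≤ j) (k : ℕ) : IntegrableOn u (dyadicInterval j k) posVolume := by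
    obtain ⟨c, hc⟩ :=
      exists_eqOn_const_dyadicInterval (hu.mono (dyadicFiltration.mono hnj) le_rfl) k
    rw [integrableOn_congr_fun hc (measurableSet_dyadicInterval j k)]
    exact integrableOn_const (by simp [posVolume_dyadicInterval])
  intro j k
  obtain hjn | hnj := le_total j n
  · induction j, hjn using Int.leInductionDown generalizing k with
    | base => exact hfine n le_rfl k
    | pred i _ ih =>
      rw [dyadicInterval_eq_union, sub_add_cancel]
      exact (ih _).union (ih _)
  · exact hfine j hnj k

theorem integral_mul_eq_zero_of_setIntegral_dyadicInterval
    (hu : Measurable[dyadicFiltration n] u)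
    (hg : ∀ k, ∫ x in dyadicInterval n k, g x ∂posVolume = 0)
    (hug : Integrable (fun x ↦ u x * g x) posVolume) : ∫ x, u x * g x ∂posVolume = 0 := by
  rw [posVolume_eq_sum_restrict n] at hug ⊢
  rw [integral_sum_measure hug]
  refine (tsum_congr fun k ↦ ?_).trans tsum_zero
  obtain ⟨c, hc⟩ := exists_eqOn_const_dyadicInterval hu k
  rw [setIntegral_congr_fun (g := fun x ↦ c * g x) (measurableSet_dyadicInterval n k)
    fun x hx ↦ by rw [hc hx], integral_const_mul, hg, mul_zero]

end DyadicIntervals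

section DyadicAverages

open Filter Topology

variable {n j : ℤ} {x : ℝ} {f g u : ℝ → ℝ} {p : ℝ≥0∞}

/-- The conditional expectation of `f` with respect to the dyadic intervals of level `n`. -/
def dyadicAvg (n : ℤ) (f : ℝ → ℝ) (x : ℝ) : ℝ :=
  2 ^ n * ∫ y in dyadicInterval n (dyadicIndex n x), f y ∂posVolume

/-- The martingale difference `dyadicAvg (n + 1) f - dyadicAvg n f`, which is the projection of `f`
to the span of the Haar functions of level `n`. -/
def dyadicDiff (n : ℤ) (f : ℝ → ℝ) (x : ℝ) : ℝ := dyadicAvg (n + 1) f x - dyadicAvg n f x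

theorem measurable_dyadicAvg (n : ℤ) (f : ℝ → ℝ) :
    Measurable[dyadicFiltration n] (dyadicAvg n f) :=
  measurable_comp_dyadicIndex
    (fun k ↦ 2 ^ n * ∫ y in dyadicInterval n k, f y ∂posVolume) n

theorem dyadicIntegrable_dyadicAvg (n : ℤ) (f : ℝ → ℝ) : DyadicIntegrable (dyadicAvg n f) :=
  dyadicIntegrable_of_measurable (measurable_dyadicAvg n f)

theorem setIntegral_const_dyadicInterval (n : ℤ) (k : ℕ) (c : ℝ) :
    ∫ _ in dyadicInterval n k, c ∂posVolume = 2 ^ (-n) * c := by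
  rw [setIntegral_const, measureReal_def, posVolume_dyadicInterval,
    ENNReal.toReal_ofReal (by positivity), smul_eq_mul]

theorem dyadicAvg_of_measurable (hu : Measurable[dyadicFiltration n] u) (hx : 0 ≤ x) :
    dyadicAvg n u x = u x := by
  obtain ⟨c, hc⟩ := exists_eqOn_const_dyadicInterval hu (dyadicIndex n x)
  rw [dyadicAvg, setIntegral_congr_fun (measurableSet_dyadicInterval _ _) hc,
    setIntegral_const_dyadicInterval, ← mul_assoc, ← zpow_add₀ two_ne_zero, add_neg_cancel,
    zpow_zero, one_mul, hc (mem_dyadicInterval_dyadicIndex n hx)]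

theorem DyadicIntegrable.setIntegral_dyadicAvg (hf : DyadicIntegrable f) (hjn : j ≤ n) (k : ℕ) :
    ∫ y in dyadicInterval j k, dyadicAvg n f y ∂posVolume =
      ∫ y in dyadicInterval j k, f y ∂posVolume := by
  induction j, hjn using Int.leInductionDown generalizing k with
  | base =>
    have h : EqOn (dyadicAvg n f) (fun _ ↦ 2 ^ n * ∫ y in dyadicInterval n k, f y ∂posVolume)
        (dyadicInterval n k) := fun x hx ↦ by rw [dyadicAvg, (mem_dyadicInterval_iff.1 hx).2]
    rw [setIntegral_congr_fun (measurableSet_dyadicInterval n k) h,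
      setIntegral_const_dyadicInterval, ← mul_assoc, ← zpow_add₀ two_ne_zero, neg_add_cancel,
      zpow_zero, one_mul]
  | pred i _ ih =>
    rw [hf.setIntegral_eq_add, (dyadicIntegrable_dyadicAvg n f).setIntegral_eq_add,
      sub_add_cancel, ih, ih]

theorem DyadicIntegrable.dyadicAvg_dyadicAvg (hf : DyadicIntegrable f) (j n : ℤ) (hx : 0 ≤ x) :
    dyadicAvg j (dyadicAvg n f) x = dyadicAvg (min j n) f x := by
  obtain hjn | hnj := le_total j n
  · rw [dyadicAvg, hf.setIntegral_dyadicAvg hjn, min_eq_left hjn, dyadicAvg]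
  · rw [min_eq_right hnj, dyadicAvg_of_measurable
      ((measurable_dyadicAvg n f).mono (dyadicFiltration.mono hnj) le_rfl) hx]

theorem enorm_dyadicAvg_le (hp : 1 ≤ p) (hf : AEStronglyMeasurable f posVolume) (n : ℤ) (x : ℝ) :
    ‖dyadicAvg n f x‖ₑ ≤ ENNReal.ofReal (2 ^ n) ^ (1 / p.toReal) *
      eLpNorm f p (posVolume.restrict (dyadicInterval n (dyadicIndex n x))) := by
  set I := dyadicInterval n (dyadicIndex n x)
  set a : ℝ≥0∞ := ENNReal.ofReal (2 ^ n)
  have ha₀ : a ≠ 0 := by simp only [a, ne_eq, ENNReal.ofReal_eq_zero, not_le]; positivity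
  have ha : a ≠ ∞ := ENNReal.ofReal_ne_top
  have hI : posVolume.restrict I univ = a⁻¹ := by
    rw [Measure.restrict_apply_univ, posVolume_dyadicInterval, zpow_neg,
      ENNReal.ofReal_inv_of_pos (by positivity)]
  have hpow : a * a⁻¹ ^ (1 - 1 / p.toReal) = a ^ (1 / p.toReal) := by
    nth_rw 1 [← ENNReal.rpow_one a]
    rw [ENNReal.inv_rpow, ← ENNReal.rpow_neg, ← ENNReal.rpow_add _ _ ha₀ ha]
    congr 1
    ring
  calc ‖dyadicAvg n f x‖ₑ
      = a * ‖∫ y in I, f y ∂posVolume‖ₑ := by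
        rw [dyadicAvg, enorm_mul, Real.enorm_of_nonneg (by positivity)]
    _ ≤ a * eLpNorm f 1 (posVolume.restrict I) := by
        rw [eLpNorm_one_eq_lintegral_enorm]
        gcongr
        exact enorm_integral_le_lintegral_enorm f
    _ ≤ a * (eLpNorm f p (posVolume.restrict I) * a⁻¹ ^ (1 - 1 / p.toReal)) := by
        gcongr
        rw [← hI]
        simpa only [ENNReal.toReal_one, div_one] using
          eLpNorm_le_eLpNorm_mul_rpow_measure_univ hp hf.restrict
    _ = a ^ (1 / p.toReal) * eLpNorm f p (posVolume.restrict I) := by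
        rw [mul_left_comm, hpow, mul_comm]

theorem eLpNorm_dyadicAvg_le (hp₁ : 1 ≤ p) (hp : p ≠ ∞) (hf : AEStronglyMeasurable f posVolume)
    (n : ℤ) : eLpNorm (dyadicAvg n f) p posVolume ≤ eLpNorm f p posVolume := by
  have hp₀ : p ≠ 0 := (zero_lt_one.trans_le hp₁).ne'
  have hr : 0 < p.toReal := ENNReal.toReal_pos hp₀ hp
  have hlocal (k : ℕ) : ∫⁻ x in dyadicInterval n k, ‖dyadicAvg n f x‖ₑ ^ p.toReal ∂posVolume ≤
      ∫⁻ x in dyadicInterval n k, ‖f x‖ₑ ^ p.toReal ∂posVolume := by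
    set A := ∫⁻ x in dyadicInterval n k, ‖f x‖ₑ ^ p.toReal ∂posVolume
    calc ∫⁻ x in dyadicInterval n k, ‖dyadicAvg n f x‖ₑ ^ p.toReal ∂posVolume
        ≤ ∫⁻ _ in dyadicInterval n k, ENNReal.ofReal (2 ^ n) * A ∂posVolume := by
          refine setLIntegral_mono' (measurableSet_dyadicInterval n k) fun x hx ↦ ?_
          have h := enorm_dyadicAvg_le hp₁ hf n x
          rwa [(mem_dyadicInterval_iff.1 hx).2, eLpNorm_eq_lintegral_rpow_enorm_toReal hp₀ hp,
            ← ENNReal.mul_rpow_of_nonneg _ _ (by positivity), one_div,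
            ENNReal.le_rpow_inv_iff hr] at h
      _ = A := by
          rw [setLIntegral_const, posVolume_dyadicInterval, mul_right_comm,
            ← ENNReal.ofReal_mul (by positivity), ← zpow_add₀ two_ne_zero, add_neg_cancel,
            zpow_zero, ENNReal.ofReal_one, one_mul]
  rw [eLpNorm_eq_lintegral_rpow_enorm_toReal hp₀ hp, eLpNorm_eq_lintegral_rpow_enorm_toReal hp₀ hp,
    posVolume_eq_sum_restrict n, lintegral_sum_measure, lintegral_sum_measure]
  exact ENNReal.rpow_le_rpow (ENNReal.tsum_le_tsum hlocal) (by positivity)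

theorem memLp_dyadicAvg (hp₁ : 1 ≤ p) (hp : p ≠ ∞) (hf : MemLp f p posVolume) (n : ℤ) :
    MemLp (dyadicAvg n f) p posVolume :=
  ⟨((measurable_dyadicAvg n f).mono (dyadicFiltration.le n) le_rfl).aestronglyMeasurable,
    (eLpNorm_dyadicAvg_le hp₁ hp hf.1 n).trans_lt hf.2⟩

theorem tendsto_dyadicAvg_neg (hp₁ : 1 ≤ p) (hp : p ≠ ∞) (hf : MemLp f p posVolume) (x : ℝ) :
    Tendsto (fun N : ℕ ↦ dyadicAvg (-N) f x) atTop (𝓝 0) := by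
  have hr : 0 < p.toReal := ENNReal.toReal_pos (zero_lt_one.trans_le hp₁).ne' hp
  have hpow : Tendsto (fun N : ℕ ↦ ENNReal.ofReal (2 ^ (-N : ℤ))) atTop (𝓝 0) := by
    rw [← ENNReal.ofReal_zero]
    refine ENNReal.tendsto_ofReal ?_
    simpa using tendsto_pow_atTop_nhds_zero_of_lt_one (r := (2 : ℝ)⁻¹) (by norm_num) (by norm_num)
  have hlim := ENNReal.Tendsto.mul_const (hpow.ennrpow_const (1 / p.toReal)) (.inr hf.2.ne)
  rw [ENNReal.zero_rpow_of_pos (by positivity), zero_mul] at hlim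
  rw [tendsto_zero_iff_enorm_tendsto_zero]
  refine tendsto_of_tendsto_of_tendsto_of_le_of_le tendsto_const_nhds hlim (fun _ ↦ zero_le)
    fun N ↦ (enorm_dyadicAvg_le hp₁ hf.1 _ x).trans ?_
  gcongr
  exact Measure.restrict_le_self

theorem DyadicIntegrable.locallyIntegrable_indicator (hf : DyadicIntegrable f) :
    LocallyIntegrable ((Ici 0).indicator f) := fun x ↦ by
  obtain ⟨n, hn⟩ := pow_unbounded_of_one_lt x one_lt_two
  refine ⟨Iio (2 ^ n), Iio_mem_nhds hn, ?_⟩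
  rw [IntegrableOn, integrable_indicator_iff measurableSet_Ici, IntegrableOn,
    Measure.restrict_restrict measurableSet_Ici, Ici_inter_Iio]
  have h := hf (-n) 0
  rw [IntegrableOn, posVolume_restrict_dyadicInterval] at h
  simpa [dyadicInterval] using h

theorem closedBall_eq_closure_dyadicInterval (n : ℤ) (k : ℕ) :
    Metric.closedBall ((k + 1 / 2) * 2 ^ (-n) : ℝ) (1 / 2 * 2 ^ (-n)) =
      Icc (k * 2 ^ (-n) : ℝ) ((k + 1) * 2 ^ (-n)) := by
  rw [Real.closedBall_eq_Icc]
  congr 1 <;> ring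

theorem dyadicAvg_eq_average (f : ℝ → ℝ) (n : ℤ) (x : ℝ) :
    dyadicAvg n f x = ⨍ y in Metric.closedBall ((dyadicIndex n x + 1 / 2) * 2 ^ (-n) : ℝ)
      (1 / 2 * 2 ^ (-n)), (Ici 0).indicator f y := by
  have hind : ∫ y in dyadicInterval n (dyadicIndex n x), f y ∂posVolume =
      ∫ y in dyadicInterval n (dyadicIndex n x), (Ici 0).indicator f y := by
    rw [posVolume_restrict_dyadicInterval]
    exact setIntegral_congr_fun (measurableSet_dyadicInterval _ _) fun y hy ↦
      (indicator_of_mem (dyadicInterval_subset_Ici _ _ hy) f).symm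
  have : (0 : ℝ) < 2 ^ (-n) := by positivity
  rw [closedBall_eq_closure_dyadicInterval, setAverage_eq, integral_Icc_eq_integral_Ico,
    Real.volume_real_Icc_of_le (by gcongr; simp), dyadicAvg, hind, smul_eq_mul, ← sub_mul,
    add_sub_cancel_left, one_mul, zpow_neg, inv_inv, dyadicInterval, zpow_neg]

theorem DyadicIntegrable.ae_tendsto_dyadicAvg (hf : DyadicIntegrable f) :
    ∀ᵐ x ∂posVolume, Tendsto (fun N : ℕ ↦ dyadicAvg N f x) atTop (𝓝 (f x)) := by
  have hlim : Tendsto (fun N : ℕ ↦ (1 / 2 * 2 ^ (-N : ℤ) : ℝ)) atTop (𝓝[>] 0) := by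
    refine tendsto_nhdsWithin_iff.2 ⟨?_, .of_forall fun N ↦ mem_Ioi.2 (by positivity)⟩
    simpa using (tendsto_pow_atTop_nhds_zero_of_lt_one (r := (2 : ℝ)⁻¹)
      (by norm_num) (by norm_num)).const_mul 2⁻¹
  have hae := IsUnifLocDoublingMeasure.ae_tendsto_average volume hf.locallyIntegrable_indicator 1
  filter_upwards [ae_restrict_of_ae hae, ae_posVolume_nonneg] with x hx hx₀
  simp only [dyadicAvg_eq_average]
  rw [← indicator_of_mem (mem_Ici.2 hx₀) f]
  refine hx _ _ hlim (.of_forall fun N ↦ ?_)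
  rw [one_mul, closedBall_eq_closure_dyadicInterval]
  exact Ico_subset_Icc_self (mem_dyadicInterval_dyadicIndex N hx₀)

end DyadicAverages

section HaarFunctions

variable {f : ℝ → ℝ} {p : ℝ≥0∞}

theorem haar_eq (j : ℤ) (k : ℕ) (x : ℝ) : haar j k x = 2 ^ ((j : ℝ) / 2) *
    ((dyadicInterval (j + 1) (2 * k)).indicator 1 x -
      (dyadicInterval (j + 1) (2 * k + 1)).indicator 1 x) := by
  have h2 : (0 : ℝ) < 2 ^ j := by positivity
  have hscale (c : ℝ) : c * 2 ^ (-(j + 1)) = c / 2 / 2 ^ j := by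
    rw [zpow_neg, zpow_add_one₀ two_ne_zero]
    field
  have hleft : x ∈ dyadicInterval (j + 1) (2 * k) ↔ 2 ^ j * x - k ∈ Ico (0 : ℝ) (1 / 2) := by
    rw [dyadicInterval, mem_Ico, mem_Ico, hscale, hscale, div_le_iff₀ h2, lt_div_iff₀ h2]
    push_cast
    constructor <;> rintro ⟨_, _⟩ <;> constructor <;> linarith
  have hright : x ∈ dyadicInterval (j + 1) (2 * k + 1) ↔
      2 ^ j * x - k ∈ Ico (1 / 2 : ℝ) 1 := by
    rw [dyadicInterval, mem_Ico, mem_Ico, hscale, hscale, div_le_iff₀ h2, lt_div_iff₀ h2]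
    push_cast
    constructor <;> rintro ⟨_, _⟩ <;> constructor <;> linarith
  simp only [haar, haarMother, indicator, hleft, hright, Pi.one_apply]

theorem DyadicIntegrable.haarCoeff_eq (hf : DyadicIntegrable f) (j : ℤ) (k : ℕ) :
    haarCoeff f j k = 2 ^ ((j : ℝ) / 2) *
      (∫ y in dyadicInterval (j + 1) (2 * k), f y ∂posVolume -
        ∫ y in dyadicInterval (j + 1) (2 * k + 1), f y ∂posVolume) := by
  have hmul (x : ℝ) : f x * haar j k x = 2 ^ ((j : ℝ) / 2) *
      ((dyadicInterval (j + 1) (2 * k)).indicator f x -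
        (dyadicInterval (j + 1) (2 * k + 1)).indicator f x) := by
    rw [haar_eq, mul_left_comm, mul_sub]
    congr 2 <;> simp [indicator]
  simp only [haarCoeff, hmul]
  rw [integral_const_mul,
    integral_sub ((hf _ _).integrable_indicator (measurableSet_dyadicInterval _ _))
      ((hf _ _).integrable_indicator (measurableSet_dyadicInterval _ _)),
    integral_indicator (measurableSet_dyadicInterval _ _),
    integral_indicator (measurableSet_dyadicInterval _ _)]

theorem DyadicIntegrable.abs_dyadicDiff (hf : DyadicIntegrable f) (j : ℤ) (x : ℝ) :
    |dyadicDiff j f x| = 2 ^ ((j : ℝ) / 2) * |haarCoeff f j (dyadicIndex j x)| := by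
  have hscale : (2 : ℝ) ^ ((j : ℝ) / 2) * 2 ^ ((j : ℝ) / 2) = 2 ^ j := by
    rw [← Real.rpow_add two_pos, add_halves, Real.rpow_intCast]
  have hhaar : 2 ^ ((j : ℝ) / 2) * |haarCoeff f j (dyadicIndex j x)| =
      |2 ^ j * (∫ y in dyadicInterval (j + 1) (2 * dyadicIndex j x), f y ∂posVolume -
        ∫ y in dyadicInterval (j + 1) (2 * dyadicIndex j x + 1), f y ∂posVolume)| := by
    rw [hf.haarCoeff_eq, abs_mul, abs_mul,
      abs_of_pos (a := (2 : ℝ) ^ ((j : ℝ) / 2)) (by positivity),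
      abs_of_pos (a := (2 : ℝ) ^ j) (by positivity), ← mul_assoc, hscale]
  rw [hhaar, dyadicDiff, dyadicAvg, dyadicAvg, hf.setIntegral_eq_add j, zpow_add_one₀ two_ne_zero]
  have hdiv := dyadicIndex_eq_div j x
  obtain h | h : dyadicIndex (j + 1) x = 2 * dyadicIndex j x ∨
      dyadicIndex (j + 1) x = 2 * dyadicIndex j x + 1 := by lia
  · rw [h]
    congr 1
    ring
  · rw [h, ← abs_neg]
    congr 1
    ring

theorem DyadicIntegrable.dyadicDiff_sq (hf : DyadicIntegrable f) (j : ℤ) (x : ℝ) :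
    dyadicDiff j f x ^ 2 = |haarCoeff f j (dyadicIndex j x)| ^ 2 *
      (volume.real (dyadicInterval j (dyadicIndex j x)))⁻¹ := by
  rw [← sq_abs, hf.abs_dyadicDiff, volume_real_dyadicInterval, mul_pow, ← Real.rpow_mul_natCast
    two_pos.le, Nat.cast_ofNat, div_mul_cancel₀ _ two_ne_zero, Real.rpow_intCast, zpow_neg, inv_inv,
    mul_comm]

theorem haarSquareFunction_eq (K : ℝ → ℝ → ℝ) (hf : DyadicIntegrable f) {x : ℝ} (hx : 0 ≤ x) :
    haarSquareFunction K f x =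
      (∑' j, ENNReal.ofReal ((eigenvalue K j * dyadicDiff j f x) ^ 2)) ^ (1 / 2 : ℝ) := by
  rw [haarSquareFunction, ENNReal.tsum_prod']
  congr 1
  refine tsum_congr fun j ↦ ?_
  rw [tsum_eq_single (dyadicIndex j x)]
  · rw [indicator_of_mem (mem_dyadicInterval_dyadicIndex j hx), Pi.one_apply, mul_one, mul_assoc,
      ← hf.dyadicDiff_sq, mul_pow]
  · intro k hk
    have hxk : x ∉ dyadicInterval j k := fun h ↦ hk (mem_dyadicInterval_iff.1 h).2.symm
    rw [indicator_of_notMem hxk, mul_zero, ENNReal.ofReal_zero]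

theorem isSymmetricMartingale_dyadicAvg (hp₁ : 1 ≤ p) (hp : p ≠ ∞) (hf : MemLp f p posVolume) :
    IsSymmetricMartingale posVolume p dyadicFiltration fun n ↦ dyadicAvg n f where
  memLp := memLp_dyadicAvg hp₁ hp hf
  measurable n := measurable_dyadicAvg n f
  measurable_abs_sub n := by
    have h := measurable_comp_dyadicIndex (fun k ↦ 2 ^ ((n : ℝ) / 2) * |haarCoeff f n k|) n
    simp only [← (dyadicIntegrable_of_memLp hp₁ hf).abs_dyadicDiff] at h
    exact h
  integral_mul_sub_eq_zero n v hv := by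
    have hloc := dyadicIntegrable_of_memLp hp₁ hf
    refine integral_mul_eq_zero_of_setIntegral_dyadicInterval hv fun k ↦ ?_
    rw [integral_sub (dyadicIntegrable_dyadicAvg _ f n k) (dyadicIntegrable_dyadicAvg _ f n k),
      hloc.setIntegral_dyadicAvg (by lia), hloc.setIntegral_dyadicAvg le_rfl, sub_self]

theorem exists_eLpNorm_squareFunction_dyadicAvg_le (hp₁ : 1 < p) (hp : p ≠ ∞) :
    ∃ C : ℝ≥0, ∀ f, MemLp f p posVolume →
      eLpNorm (squareFunction fun n ↦ dyadicAvg n f) p posVolume ≤ C * eLpNorm f p posVolume := by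
  obtain ⟨C, hC⟩ :=
    IsSymmetricMartingale.exists_eLpNorm_squareFunction_le posVolume dyadicFiltration hp₁ hp
  exact ⟨C, fun f hf ↦ hC _ (isSymmetricMartingale_dyadicAvg hp₁.le hp hf) _
    (eLpNorm_dyadicAvg_le hp₁.le hp hf.1)⟩

theorem exists_eLpNorm_le_squareFunction_dyadicAvg (hp₁ : 1 ≤ p) (hp : p ≠ ∞) :
    ∃ C : ℝ≥0, ∀ f, MemLp f p posVolume →
      eLpNorm f p posVolume ≤ C * eLpNorm (squareFunction fun n ↦ dyadicAvg n f) p posVolume := by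
  obtain ⟨C, hC⟩ := IsSymmetricMartingale.exists_eLpNorm_limit_le posVolume dyadicFiltration
    (zero_lt_one.trans_le hp₁).ne' hp
  exact ⟨C, fun f hf ↦ hC _ (isSymmetricMartingale_dyadicAvg hp₁ hp hf) f
    (dyadicIntegrable_of_memLp hp₁ hf).ae_tendsto_dyadicAvg
    (.of_forall (tendsto_dyadicAvg_neg hp₁ hp hf))⟩

end HaarFunctions

section DyadicShells

variable {n j : ℤ} {x y : ℝ} {f : ℝ → ℝ}

/-- The points whose smallest common dyadic interval with `x ≥ 0` has level `n`, that is, those at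
dyadic distance `2 ^ (-n)` from `x`. -/
def dyadicShell (n : ℤ) (x : ℝ) : Set ℝ :=
  dyadicInterval n (dyadicIndex n x) \ dyadicInterval (n + 1) (dyadicIndex (n + 1) x)

theorem mem_dyadicShell : y ∈ dyadicShell n x ↔
    0 ≤ y ∧ dyadicIndex n y = dyadicIndex n x ∧ dyadicIndex (n + 1) y ≠ dyadicIndex (n + 1) x := by
  simp only [dyadicShell, mem_sdiff, mem_dyadicInterval_iff]
  tauto

theorem measurableSet_dyadicShell (n : ℤ) (x : ℝ) : MeasurableSet (dyadicShell n x) :=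
  (measurableSet_dyadicInterval _ _).diff (measurableSet_dyadicInterval _ _)

theorem pairwise_disjoint_dyadicShell (x : ℝ) :
    Pairwise (Function.onFun Disjoint fun n ↦ dyadicShell n x) := by
  refine (pairwise_disjoint_on _).2 fun m n hmn ↦ Set.disjoint_left.2 fun y hm hn ↦ ?_
  exact (mem_dyadicShell.1 hm).2.2 (dyadicIndex_eq_of_le hmn (mem_dyadicShell.1 hn).2.1)

theorem dyadicDist_of_mem_dyadicShell (hx : 0 ≤ x) (hy : y ∈ dyadicShell n x) :
    dyadicDist x y = 2 ^ (-n) := by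
  obtain ⟨hy₀, heq, hne⟩ := mem_dyadicShell.1 hy
  refine IsLeast.csInf_eq ⟨⟨n, dyadicIndex n x, mem_dyadicInterval_dyadicIndex n hx,
    mem_dyadicInterval_iff.2 ⟨hy₀, heq⟩, (volume_real_dyadicInterval _ _).symm⟩, ?_⟩
  rintro r ⟨j, k, hjx, hjy, rfl⟩
  have hjn : ¬ n + 1 ≤ j := fun h ↦ hne <| dyadicIndex_eq_of_le h <|
    (mem_dyadicInterval_iff.1 hjy).2.trans (mem_dyadicInterval_iff.1 hjx).2.symm
  rw [volume_real_dyadicInterval]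
  exact zpow_le_zpow_right₀ one_le_two (by lia)

theorem exists_forall_dyadicIndex_eq_imp_le (hx : 0 ≤ x) (hy : 0 ≤ y) (hyx : y ≠ x) :
    ∃ b : ℤ, ∀ n, dyadicIndex n y = dyadicIndex n x → n ≤ b := by
  have hpos : 0 < |y - x| := abs_pos.2 (sub_ne_zero.2 hyx)
  obtain ⟨b, hb⟩ := pow_unbounded_of_one_lt |y - x|⁻¹ one_lt_two
  refine ⟨b, fun n hn ↦ not_lt.1 fun hbn ↦ ?_⟩
  have hfloor : dyadicIndex b y = dyadicIndex b x := dyadicIndex_eq_of_le hbn.le hn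
  have hdist : |2 ^ b * y - 2 ^ b * x| < 1 := by
    refine Int.abs_sub_lt_one_of_floor_eq_floor ?_
    rw [← Int.natCast_floor_eq_floor (by positivity), ← Int.natCast_floor_eq_floor (by positivity)]
    simpa [dyadicIndex] using hfloor
  rw [← mul_sub, abs_mul, abs_of_pos (by positivity), ← lt_inv_mul_iff₀ (by positivity), mul_one,
    lt_inv_comm₀ hpos (by positivity)] at hdist
  exact hb.asymm hdist

theorem exists_dyadicIndex_eq (x y : ℝ) : ∃ n, dyadicIndex n y = dyadicIndex n x := by
  obtain ⟨b, hb⟩ := pow_unbounded_of_one_lt (max x y) one_lt_two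
  have hzero (z : ℝ) (hz : z ≤ max x y) : dyadicIndex (-b) z = 0 := by
    rw [dyadicIndex, Nat.floor_eq_zero, zpow_neg, zpow_natCast, inv_mul_lt_iff₀ (by positivity),
      mul_one]
    exact hz.trans_lt hb
  exact ⟨-b, by rw [hzero x (le_max_left _ _), hzero y (le_max_right _ _)]⟩

theorem iUnion_dyadicShell (hx : 0 ≤ x) : ⋃ n, dyadicShell n x = Ici 0 \ {x} := by
  ext y
  simp only [mem_iUnion, mem_dyadicShell, mem_sdiff, mem_Ici, mem_singleton_iff]
  refine ⟨fun ⟨n, hy, _, hne⟩ ↦ ⟨hy, fun h ↦ hne (by rw [h])⟩, fun ⟨hy, hyx⟩ ↦ ?_⟩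
  obtain ⟨b, hb⟩ := exists_forall_dyadicIndex_eq_imp_le hx hy hyx
  obtain ⟨n, hn, hmax⟩ := Int.exists_greatest_of_bdd ⟨b, hb⟩ (exists_dyadicIndex_eq x y)
  exact ⟨n, hy, hn, fun h ↦ (hmax _ h).not_gt (lt_add_one n)⟩

theorem posVolume_restrict_iUnion_dyadicShell (hx : 0 ≤ x) :
    posVolume.restrict (⋃ n, dyadicShell n x) = posVolume := by
  rw [iUnion_dyadicShell hx, posVolume, Measure.restrict_restrict (by measurability),
    inter_eq_left.2 sdiff_subset]
  exact Measure.restrict_congr_set (sdiff_null_ae_eq_self Real.volume_singleton)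

theorem DyadicIntegrable.integrableOn_dyadicShell (hf : DyadicIntegrable f) (n : ℤ) (x : ℝ) :
    IntegrableOn f (dyadicShell n x) posVolume :=
  (hf _ _).mono_set sdiff_subset

theorem DyadicIntegrable.setIntegral_dyadicShell (hf : DyadicIntegrable f) (n : ℤ) (x : ℝ) :
    ∫ y in dyadicShell n x, f y ∂posVolume =
      2 ^ (-(n + 1)) * (2 * dyadicAvg n f x - dyadicAvg (n + 1) f x) := by
  have hsub : dyadicInterval (n + 1) (dyadicIndex (n + 1) x) ⊆
      dyadicInterval n (dyadicIndex n x) := fun y hy ↦ by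
    rw [mem_dyadicInterval_iff] at hy ⊢
    exact ⟨hy.1, dyadicIndex_eq_of_le (by lia) hy.2⟩
  rw [dyadicShell, setIntegral_sdiff (measurableSet_dyadicInterval _ _) (hf _ _) hsub, dyadicAvg,
    dyadicAvg, zpow_neg, zpow_add_one₀ two_ne_zero]
  field

end DyadicShells

section Series

variable {Ω ι : Type*} {m : MeasurableSpace Ω} {μ : Measure Ω} {p : ℝ≥0∞} [Countable ι]

theorem memLp_of_ae_hasSum (hp : 1 ≤ p) {f : ι → Ω → ℝ} {g : Ω → ℝ} (hf : ∀ i, MemLp (f i) p μ)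
    (hsum : ∑' i, eLpNorm (f i) p μ ≠ ∞) (hg : ∀ᵐ x ∂μ, HasSum (f · x) (g x)) : MemLp g p μ := by
  have : Fact (1 ≤ p) := ⟨hp⟩
  have hLp : ∑' i, ‖(hf i).toLp‖ₑ ≠ ∞ := by simpa only [Lp.enorm_toLp] using hsum
  refine (Lp.memLp (∑' i, (hf i).toLp)).ae_eq ?_
  filter_upwards [Lp.hasSum_coeFn_tsum hLp, ae_all_iff.2 fun i ↦ (hf i).coeFn_toLp, hg]
    with x hx hfx hgx
  simp only [hfx] at hx
  exact hx.unique hgx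

theorem hasSum_dyadicAvg (hp : 1 ≤ p) {f : ι → ℝ → ℝ} {g : ℝ → ℝ}
    (hf : ∀ i, MemLp (f i) p posVolume) (hsum : ∑' i, eLpNorm (f i) p posVolume ≠ ∞)
    (hg : ∀ᵐ x ∂posVolume, HasSum (f · x) (g x)) (n : ℤ) (x : ℝ) :
    HasSum (fun i ↦ dyadicAvg n (f i) x) (dyadicAvg n g x) := by
  have hsumm : Summable fun i ↦
      ∫ y in dyadicInterval n (dyadicIndex n x), ‖f i y‖ ∂posVolume := by
    rw [← summable_mul_left_iff (zpow_ne_zero n two_ne_zero)]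
    refine (tsum_enorm_ne_top_iff_summable_norm.1 (ne_top_of_le_ne_top ?_ <|
      ENNReal.tsum_le_tsum fun i ↦ enorm_dyadicAvg_le hp (hf i).1.norm n x)).of_norm
    rw [ENNReal.tsum_mul_left]
    refine ENNReal.mul_ne_top
      (ENNReal.rpow_ne_top_of_nonneg (by positivity) ENNReal.ofReal_ne_top)
      (ne_top_of_le_ne_top hsum (ENNReal.tsum_le_tsum fun i ↦ ?_))
    rw [eLpNorm_norm]
    exact eLpNorm_restrict_le _ _ _ _
  have h := hasSum_integral_of_summable_integral_norm
    (fun i ↦ dyadicIntegrable_of_memLp hp (hf i) n (dyadicIndex n x)) hsumm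
  rw [integral_congr_ae (ae_restrict_of_ae (hg.mono fun y hy ↦ hy.tsum_eq))] at h
  exact h.mul_left _

end Series

section KernelOperator

variable {K : ℝ → ℝ → ℝ} {f : ℝ → ℝ} {p : ℝ≥0∞} {x : ℝ}

/-- The mass that `K x` gives to `dyadicShell n x`, for any `x ≥ 0`: the value of the kernel at
dyadic distance `2 ^ (-n)` times the measure `2 ^ (-(n + 1))` of the shell. -/
def levelMass (K : ℝ → ℝ → ℝ) (n : ℤ) : ℝ := levelCoeff K (-n) * 2 ^ (-(n + 1))

/-- The contribution of `dyadicShell n x` to `kernelOp K f x`, written through dyadic averages. -/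
def kernelTerm (K : ℝ → ℝ → ℝ) (n : ℤ) (f : ℝ → ℝ) (x : ℝ) : ℝ :=
  levelMass K n * (2 * dyadicAvg n f x - dyadicAvg (n + 1) f x)

theorem kernel_eq_of_mem_dyadicShell (hK : IsDyadicMarkovKernel K) (hx : 0 ≤ x) {n : ℤ} {y : ℝ}
    (hy : y ∈ dyadicShell n x) : K x y = levelCoeff K (-n) :=
  hK.eq_levelCoeff hx (mem_dyadicShell.1 hy).1 (dyadicDist_of_mem_dyadicShell hx hy)

theorem setIntegral_kernel_mul_dyadicShell (hK : IsDyadicMarkovKernel K) (hf : DyadicIntegrable f)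
    (hx : 0 ≤ x) (n : ℤ) :
    ∫ y in dyadicShell n x, K x y * f y ∂posVolume = kernelTerm K n f x := by
  have heq : EqOn (fun y ↦ K x y * f y) (fun y ↦ levelCoeff K (-n) * f y) (dyadicShell n x) :=
    fun y hy ↦ by simp only [kernel_eq_of_mem_dyadicShell hK hx hy]
  rw [setIntegral_congr_fun (measurableSet_dyadicShell n x) heq, integral_const_mul,
    hf.setIntegral_dyadicShell, ← mul_assoc, kernelTerm, levelMass]

theorem hasSum_kernelTerm (hK : IsDyadicMarkovKernel K) (hf : DyadicIntegrable f) (hx : 0 ≤ x)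
    (hint : Integrable (fun y ↦ K x y * f y) posVolume) :
    HasSum (kernelTerm K · f x) (kernelOp K f x) := by
  have h := hasSum_integral_iUnion (μ := posVolume) (measurableSet_dyadicShell · x)
    (pairwise_disjoint_dyadicShell x) hint.integrableOn
  simp only [posVolume_restrict_iUnion_dyadicShell hx,
    setIntegral_kernel_mul_dyadicShell hK hf hx] at h
  exact h

theorem hasSum_levelMass (hK : IsDyadicMarkovKernel K) : HasSum (levelMass K) 1 := by
  obtain ⟨x₀, hx₀, hint⟩ := hK.exists_integral_eq_one
  have hone (n : ℤ) : Measurable[dyadicFiltration n] fun _ : ℝ ↦ (1 : ℝ) := measurable_const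
  have hK₁ : Integrable (K x₀) posVolume := .of_integral_ne_zero (by rw [hint]; exact one_ne_zero)
  have h := hasSum_kernelTerm hK (dyadicIntegrable_of_measurable (hone 0)) hx₀
    (by simpa only [mul_one] using hK₁)
  simp only [kernelTerm, kernelOp, dyadicAvg_of_measurable (hone _) hx₀, mul_one, hint] at h
  norm_num at h
  exact h

theorem memLp_kernelTerm (hp₁ : 1 ≤ p) (hp : p ≠ ∞) (hf : MemLp f p posVolume) (n : ℤ) :
    MemLp (kernelTerm K n f) p posVolume :=
  (((memLp_dyadicAvg hp₁ hp hf n).const_mul 2).sub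
    (memLp_dyadicAvg hp₁ hp hf (n + 1))).const_mul _

theorem eLpNorm_kernelTerm_le (hp₁ : 1 ≤ p) (hp : p ≠ ∞) (hf : MemLp f p posVolume) (n : ℤ) :
    eLpNorm (kernelTerm K n f) p posVolume ≤ ‖levelMass K n‖ₑ * (3 * eLpNorm f p posVolume) := by
  have havg (m : ℤ) := memLp_dyadicAvg hp₁ hp hf m
  calc eLpNorm (kernelTerm K n f) p posVolume
      = ‖levelMass K n‖ₑ *
          eLpNorm ((2 : ℝ) • dyadicAvg n f - dyadicAvg (n + 1) f) p posVolume :=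
        eLpNorm_const_smul (levelMass K n) _ _ _
    _ ≤ ‖levelMass K n‖ₑ * (2 * eLpNorm f p posVolume + eLpNorm f p posVolume) := by
        gcongr
        refine (eLpNorm_sub_le ((havg n).1.const_smul _) (havg (n + 1)).1 hp₁).trans ?_
        rw [eLpNorm_const_smul, Real.enorm_of_nonneg zero_le_two, ENNReal.ofReal_ofNat]
        gcongr <;> exact eLpNorm_dyadicAvg_le hp₁ hp hf.1 _
    _ = ‖levelMass K n‖ₑ * (3 * eLpNorm f p posVolume) := by ring

theorem tsum_eLpNorm_kernelTerm_ne_top (hK : IsDyadicMarkovKernel K) (hp₁ : 1 ≤ p) (hp : p ≠ ∞)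
    (hf : MemLp f p posVolume) : ∑' n, eLpNorm (kernelTerm K n f) p posVolume ≠ ∞ := by
  refine ne_top_of_le_ne_top ?_ (ENNReal.tsum_le_tsum (eLpNorm_kernelTerm_le hp₁ hp hf))
  rw [ENNReal.tsum_mul_right]
  exact ENNReal.mul_ne_top
    (tsum_enorm_ne_top_iff_summable_norm.2 (hasSum_levelMass hK).summable.norm)
    (ENNReal.mul_ne_top ENNReal.ofNat_ne_top hf.2.ne)

theorem ae_integrable_kernel_mul (hK : IsDyadicMarkovKernel K) (hp₁ : 1 ≤ p) (hp : p ≠ ∞)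
    (hf : MemLp f p posVolume) :
    ∀ᵐ x ∂posVolume, Integrable (fun y ↦ K x y * f y) posVolume := by
  have hsumm := summable_norm_of_tsum_eLpNorm_ne_top hp₁
    (fun n ↦ (memLp_kernelTerm hp₁ hp hf.norm n).1)
    (tsum_eLpNorm_kernelTerm_ne_top hK hp₁ hp hf.norm)
  filter_upwards [hsumm, ae_posVolume_nonneg] with x hx hx₀
  have hshell (n : ℤ) : ∫ y in dyadicShell n x, ‖K x y * f y‖ ∂posVolume =
      kernelTerm K n (fun y ↦ ‖f y‖) x := by
    rw [← setIntegral_kernel_mul_dyadicShell hK (dyadicIntegrable_of_memLp hp₁ hf.norm) hx₀]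
    refine setIntegral_congr_fun (measurableSet_dyadicShell n x) fun y hy ↦ ?_
    simp only [norm_mul, Real.norm_of_nonneg (hK.nonneg x y hx₀ (mem_dyadicShell.1 hy).1)]
  have hint (n : ℤ) : IntegrableOn (fun y ↦ K x y * f y) (dyadicShell n x) posVolume :=
    IntegrableOn.congr_fun
      (((dyadicIntegrable_of_memLp hp₁ hf).integrableOn_dyadicShell n x).const_mul
        (levelCoeff K (-n)))
      (fun y hy ↦ by simp only [kernel_eq_of_mem_dyadicShell hK hx₀ hy])
      (measurableSet_dyadicShell n x)
  rw [← posVolume_restrict_iUnion_dyadicShell hx₀]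
  refine integrableOn_iUnion_of_summable_integral_norm hint ?_
  simpa only [hshell] using hx.of_norm

theorem ae_hasSum_kernelTerm (hK : IsDyadicMarkovKernel K) (hp₁ : 1 ≤ p) (hp : p ≠ ∞)
    (hf : MemLp f p posVolume) :
    ∀ᵐ x ∂posVolume, HasSum (kernelTerm K · f x) (kernelOp K f x) := by
  filter_upwards [ae_integrable_kernel_mul hK hp₁ hp hf, ae_posVolume_nonneg] with x hx hx₀
  exact hasSum_kernelTerm hK (dyadicIntegrable_of_memLp hp₁ hf) hx₀ hx

theorem memLp_kernelOp (hK : IsDyadicMarkovKernel K) (hp₁ : 1 ≤ p) (hp : p ≠ ∞)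
    (hf : MemLp f p posVolume) : MemLp (kernelOp K f) p posVolume :=
  memLp_of_ae_hasSum hp₁ (memLp_kernelTerm hp₁ hp hf)
    (tsum_eLpNorm_kernelTerm_ne_top hK hp₁ hp hf) (ae_hasSum_kernelTerm hK hp₁ hp hf)

theorem DyadicIntegrable.dyadicDiff_dyadicAvg (hf : DyadicIntegrable f) (j n : ℤ) (hx : 0 ≤ x) :
    dyadicDiff j (dyadicAvg n f) x = (Iio n).indicator 1 j * dyadicDiff j f x := by
  rw [dyadicDiff, hf.dyadicAvg_dyadicAvg _ _ hx, hf.dyadicAvg_dyadicAvg _ _ hx, dyadicDiff]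
  obtain hjn | hnj := lt_or_ge j n
  · simp [min_eq_left hjn.le, hjn]
  · simp [min_eq_right hnj, min_eq_right (hnj.trans (lt_add_one j).le), hnj.not_gt]

theorem dyadicAvg_kernelTerm (j n : ℤ) :
    dyadicAvg j (kernelTerm K n f) x = levelMass K n *
      (2 * dyadicAvg j (dyadicAvg n f) x - dyadicAvg j (dyadicAvg (n + 1) f) x) := by
  have h (m : ℤ) := dyadicIntegrable_dyadicAvg m f j (dyadicIndex j x)
  simp only [dyadicAvg.eq_def j, kernelTerm]
  rw [integral_const_mul, integral_sub ((h n).const_mul 2) (h (n + 1)), integral_const_mul]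
  ring

theorem DyadicIntegrable.dyadicDiff_kernelTerm (hf : DyadicIntegrable f) (j n : ℤ) (hx : 0 ≤ x) :
    dyadicDiff j (kernelTerm K n f) x = levelMass K n *
      (2 * (Iio n).indicator 1 j - (Iio (n + 1)).indicator 1 j) * dyadicDiff j f x := by
  rw [mul_assoc, sub_mul, mul_assoc, ← hf.dyadicDiff_dyadicAvg j n hx,
    ← hf.dyadicDiff_dyadicAvg j (n + 1) hx, dyadicDiff, dyadicAvg_kernelTerm, dyadicAvg_kernelTerm]
  simp only [dyadicDiff]
  ring

theorem alphaCoeff_eq_sub_levelMass (K : ℝ → ℝ → ℝ) (l : ℤ) :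
    alphaCoeff K l = 2 * levelMass K l - levelMass K (l - 1) := by
  rw [alphaCoeff, levelMass, levelMass, sub_add_cancel, neg_add', zpow_sub_one₀ two_ne_zero,
    neg_sub, sub_eq_neg_add]
  ring_nf

theorem hasSum_eigenvalue (hK : IsDyadicMarkovKernel K) (j : ℤ) :
    HasSum (fun n ↦ levelMass K n * (2 * (Iio n).indicator 1 j - (Iio (n + 1)).indicator 1 j))
      (eigenvalue K j) := by
  have hind (m : ℤ) (g : ℤ → ℝ) : (Ioi j).indicator g m = g m * (Iio m).indicator 1 j := by
    simp [indicator_apply]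
  have hmass := (hasSum_levelMass hK).summable
  have hmul : Summable fun l ↦ 2 * (Ioi j).indicator (levelMass K) l :=
    (hmass.indicator _).mul_left 2
  have hshift : Summable ((Ioi j).indicator fun l ↦ levelMass K (l - 1)) :=
    ((Equiv.subRight 1).summable_iff.2 hmass).indicator _
  have heig : eigenvalue K j = ∑' l, (2 * (Ioi j).indicator (levelMass K) l -
      (Ioi j).indicator (fun l ↦ levelMass K (l - 1)) l) := by
    refine (tsum_subtype (Ioi j) (alphaCoeff K)).trans (tsum_congr fun l ↦ ?_)
    simp only [hind, alphaCoeff_eq_sub_levelMass]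
    ring
  rw [heig, hmul.tsum_sub hshift]
  refine (hmul.hasSum.sub ((Equiv.addRight (1 : ℤ)).hasSum_iff.2 hshift.hasSum)).congr_fun
    fun n ↦ ?_
  simp only [hind, Function.comp_apply, Equiv.coe_addRight, add_sub_cancel_right]
  ring

theorem dyadicDiff_kernelOp (hK : IsDyadicMarkovKernel K) (hp₁ : 1 ≤ p) (hp : p ≠ ∞)
    (hf : MemLp f p posVolume) (j : ℤ) (hx : 0 ≤ x) :
    dyadicDiff j (kernelOp K f) x = eigenvalue K j * dyadicDiff j f x := by
  have havg (m : ℤ) := hasSum_dyadicAvg hp₁ (memLp_kernelTerm hp₁ hp hf)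
    (tsum_eLpNorm_kernelTerm_ne_top hK hp₁ hp hf) (ae_hasSum_kernelTerm hK hp₁ hp hf) m x
  have hdiff : HasSum (fun n ↦ dyadicDiff j (kernelTerm K n f) x) (dyadicDiff j (kernelOp K f) x) :=
    (havg (j + 1)).sub (havg j)
  simp only [(dyadicIntegrable_of_memLp hp₁ hf).dyadicDiff_kernelTerm j _ hx] at hdiff
  exact hdiff.unique ((hasSum_eigenvalue hK j).mul_right _)

theorem eLpNorm_haarSquareFunction_eq (hK : IsDyadicMarkovKernel K) (hp₁ : 1 ≤ p) (hp : p ≠ ∞)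
    (hf : MemLp f p posVolume) :
    eLpNorm (haarSquareFunction K f) p posVolume =
      eLpNorm (squareFunction fun n ↦ dyadicAvg n (kernelOp K f)) p posVolume := by
  refine eLpNorm_congr_ae (ae_posVolume_nonneg.mono fun x hx ↦ ?_)
  rw [haarSquareFunction_eq K (dyadicIntegrable_of_memLp hp₁ hf) hx]
  simp only [← dyadicDiff_kernelOp hK hp₁ hp hf _ hx]
  rfl

end KernelOperator

end

end DyadicMarkov

theorem theorem4p4 (K : ℝ → ℝ → ℝ) (hK : DyadicMarkov.IsDyadicMarkovKernel K)
    (p : ℝ≥0∞) (hp₁ : 1 < p) (hp₂ : p < ∞) :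
    (∀ f : ℝ → ℝ, MemLp f p DyadicMarkov.posVolume →
      (∀ᵐ x ∂DyadicMarkov.posVolume,
        Integrable (fun y => K x y * f y) DyadicMarkov.posVolume) ∧
      MemLp (DyadicMarkov.kernelOp K f) p DyadicMarkov.posVolume) ∧
    ∃ C₁ C₂ : ℝ≥0, 0 < C₁ ∧ 0 < C₂ ∧
      ∀ f : ℝ → ℝ, MemLp f p DyadicMarkov.posVolume →
        C₁ * eLpNorm (DyadicMarkov.kernelOp K f) p DyadicMarkov.posVolume ≤
            eLpNorm (DyadicMarkov.haarSquareFunction K f) p DyadicMarkov.posVolume ∧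
          eLpNorm (DyadicMarkov.haarSquareFunction K f) p DyadicMarkov.posVolume ≤
            C₂ * eLpNorm (DyadicMarkov.kernelOp K f) p DyadicMarkov.posVolume := by
  refine ⟨fun f hf ↦ ⟨DyadicMarkov.ae_integrable_kernel_mul hK hp₁.le hp₂.ne hf,
    DyadicMarkov.memLp_kernelOp hK hp₁.le hp₂.ne hf⟩, ?_⟩
  obtain ⟨A, hA⟩ := DyadicMarkov.exists_eLpNorm_le_squareFunction_dyadicAvg hp₁.le hp₂.ne
  obtain ⟨B, hB⟩ := DyadicMarkov.exists_eLpNorm_squareFunction_dyadicAvg_le hp₁ hp₂.ne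
  refine ⟨(A + 1)⁻¹, B + 1, by positivity, by positivity, fun f hf ↦ ?_⟩
  have hTf := DyadicMarkov.memLp_kernelOp hK hp₁.le hp₂.ne hf
  rw [DyadicMarkov.eLpNorm_haarSquareFunction_eq hK hp₁.le hp₂.ne hf]
  constructor
  · rw [ENNReal.coe_inv (by positivity), ENNReal.inv_mul_le_iff (by simp) (by simp)]
    refine (hA _ hTf).trans ?_
    gcongr
    exact le_self_add
  · refine (hB _ hTf).trans ?_
    gcongr
    exact le_self_add
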